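/- Let $q\in\mathbb C$ with $|q|=1$, $q\neq\pm1$, $q^2\neq-1$; fix a square root $q^{1/2}$ and put $[2]_q=q+q^{-1}$. Let $I$ be a linearly ordered set containing indices $0<1<\dots<6$, and let $H_I$ be the unital $\mathbb C$-algebra with generators $x_i,y_i$ $(i\in I)$ and relations $x_iy_i=q\,y_ix_i$ and, for $i<j$, $$x_jx_i=q^2x_ix_j,\quad y_jy_i=q^2y_iy_j,\quad x_jy_i=q\,y_ix_j+(q^2-1)x_iy_j,\quad y_jx_i=q\,x_iy_j .$$ The operators $K,E,F$ of $U_q(sl(2))$ act on $H_I$ by $K1=1$, $Kx_i=q^{-1/2}x_i$, $Ky_i=q^{1/2}y_i$, $E1=F1=0$, $Ex_i=q^{1/2}y_i$, $Ey_i=0$, $Fx_i=0$, $Fy_i=q^{-1/2}x_i$ and $K(ab)=K(a)K(b)$, $E(ab)=E(a)K(b)+K^{-1}(a)E(b)$, $F(ab)=F(a)K(b)+K^{-1}(a)F(b)$; an element $a$ is invariant if $Ea=Fa=0$ and $Ka=a$. A quadratic form $f=x_0^2A+[2]_q\,x_0y_0B+y_0^2C$ is given by its coefficients $(A,B,C)$.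 With $(ij)=q^{-1/2}x_iy_j-q^{1/2}y_ix_j$, the form $f_{ij}=q\,(0i)(0j)$, $0<i<j$, has the coefficients $$A=q\,y_iy_j,\qquad B=\frac{-q^2x_iy_j-q\,y_ix_j}{[2]_q},\qquad C=q^3x_ix_j .$$ The Jacobian $J_{f,f'}$ of forms with coefficients $(A,B,C)$, $(A',B',C')$ is the form $x_0^2K+x_0y_0L+y_0^2M$ (so its coefficients are $(K,L/[2]_q,M)$) with $$K=q^9AB'-q^7BA',\quad L=q^7AC'-q^7CA'+(q^{10}-q^6)BB',\quad M=q^9BC'-q^7CB',$$ and the combinant of three forms is $$C_{f,f',f''}=q^{-5/2}AB'C''-q^{-9/2}\bigl(AC'B''+BA'C''-BC'A''-CA'B''\bigr)-q^{-13/2}CB'A''-(q^{-3/2}-q^{-11/2})BB'B''.$$ Put $J_1=J_{f_{12},f_{45}}$, $J_2=J_{f_{23},f_{56}}$, $J_3=J_{f_{34},f_{16}}$, $J_4=J_{f_{16},f_{34}}$ and, for $a_1,\dots,a_{12}\in\mathbb C$, $$\begin{aligned}C_{a_1,\dots,a_{12}}={}&a_1C_{J_1,J_2,J_3}+a_2C_{J_2,J_3,J_1}+a_3C_{J_3,J_1,J_2}-a_4C_{J_1,J_3,J_2}-a_5C_{J_3,J_2,J_1}-a_6C_{J_2,J_1,J_3}\\&-a_7C_{J_1,J_2,J_4}-a_8C_{J_2,J_4,J_1}-a_9C_{J_4,J_1,J_2}+a_{10}C_{J_1,J_4,J_2}+a_{11}C_{J_4,J_2,J_1}+a_{12}C_{J_2,J_1,J_4}.\end{aligned}$$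 **Theorem.** Every $C_{a_1,\dots,a_{12}}$ is an invariant element of $H_I$. Let $D=q^{12}-4q^{10}+4q^8-6q^4+6q^2-2$. If there are $\alpha,\beta\in\mathbb C$ with $$\begin{aligned} a_1=a_9&=\alpha,\qquad a_2=a_8=\beta,\\ a_3=a_7&=-q^2\,\frac{2q^8-5q^6+2q^4+2q^2-2}{D}\,\alpha,\\ a_4=a_{10}&=2q^2\,\frac{q^{16}-3q^{14}+2q^{12}+3q^{10}-6q^8+3q^6+2q^4-3q^2+1}{D}\,\alpha+q^{14}\beta,\\ a_5=a_{12}&=-q^{-4}\,\frac{2q^8-2q^6-2q^4+5q^2-2}{D}\,\alpha,\\ a_6=a_{11}&=q^{-6}\,\frac{2q^{12}-6q^{10}+6q^8-4q^4+4q^2-1}{D}\,\alpha, \end{aligned}$$ then $C_{a_1,\dots,a_{12}}=0$. If moreover $q^4\neq-1$ and $q^4-q^2+1\neq0$ (that is, $q$ is not a primitive 8th or 12th root of unity), then $C_{a_1,\dots,a_{12}}=0$ if and only if there are such $\alpha,\beta\in\mathbb C$. -/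

import Mathlib

set_option linter.unusedSimpArgs false
set_option linter.unusedTactic false
set_option linter.unreachableTactic false
set_option linter.unnecessarySeqFocus false

/-- The generators `x i`, `y i` of the algebra of quantum homogeneous coordinates. -/
inductive QGen (I : Type*) where
  | x (i : I) : QGen I
  | y (i : I) : QGen I

/-- The defining relations of the algebra `H_I`, for an ordered index set `I`. -/
inductive QRel (q : ℂ) (I : Type*) [LinearOrder I] :
    FreeAlgebra ℂ (QGen I) → FreeAlgebra ℂ (QGen I) → Prop where
  | xy (i : I) : QRel q I
      (FreeAlgebra.ι ℂ (QGen.x i) * FreeAlgebra.ι ℂ (QGen.y i))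
      (q • (FreeAlgebra.ι ℂ (QGen.y i) * FreeAlgebra.ι ℂ (QGen.x i)))
  | xx (i j : I) (h : i < j) : QRel q I
      (FreeAlgebra.ι ℂ (QGen.x j) * FreeAlgebra.ι ℂ (QGen.x i))
      (q ^ 2 • (FreeAlgebra.ι ℂ (QGen.x i) * FreeAlgebra.ι ℂ (QGen.x j)))
  | yy (i j : I) (h : i < j) : QRel q I
      (FreeAlgebra.ι ℂ (QGen.y j) * FreeAlgebra.ι ℂ (QGen.y i))
      (q ^ 2 • (FreeAlgebra.ι ℂ (QGen.y i) * FreeAlgebra.ι ℂ (QGen.y j)))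
  | xjyi (i j : I) (h : i < j) : QRel q I
      (FreeAlgebra.ι ℂ (QGen.x j) * FreeAlgebra.ι ℂ (QGen.y i))
      (q • (FreeAlgebra.ι ℂ (QGen.y i) * FreeAlgebra.ι ℂ (QGen.x j)) +
        (q ^ 2 - 1) • (FreeAlgebra.ι ℂ (QGen.x i) * FreeAlgebra.ι ℂ (QGen.y j)))
  | yjxi (i j : I) (h : i < j) : QRel q I
      (FreeAlgebra.ι ℂ (QGen.y j) * FreeAlgebra.ι ℂ (QGen.x i))
      (q • (FreeAlgebra.ι ℂ (QGen.x i) * FreeAlgebra.ι ℂ (QGen.y j)))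

/-- The unital algebra `H_I` with generators `x i`, `y i` and the relations `QRel`. -/
def QAlg (q : ℂ) (I : Type*) [LinearOrder I] : Type _ := RingQuot (QRel q I)

noncomputable instance (q : ℂ) (I : Type*) [LinearOrder I] : Ring (QAlg q I) :=
  inferInstanceAs (Ring (RingQuot (QRel q I)))

noncomputable instance (q : ℂ) (I : Type*) [LinearOrder I] : Algebra ℂ (QAlg q I) :=
  inferInstanceAs (Algebra ℂ (RingQuot (QRel q I)))

/-- The quotient map from the free algebra to `H_I`. -/
noncomputable def qMk (q : ℂ) (I : Type*) [LinearOrder I] :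
    FreeAlgebra ℂ (QGen I) →ₐ[ℂ] QAlg q I :=
  RingQuot.mkAlgHom ℂ (QRel q I)

theorem qMk_rel {q : ℂ} {I : Type*} [LinearOrder I] {a b : FreeAlgebra ℂ (QGen I)}
    (h : QRel q I a b) : qMk q I a = qMk q I b :=
  RingQuot.mkAlgHom_rel ℂ h

theorem qMk_surjective (q : ℂ) (I : Type*) [LinearOrder I] : Function.Surjective (qMk q I) :=
  RingQuot.mkAlgHom_surjective ℂ (QRel q I)

section QAlg

variable (q : ℂ) {I : Type*} [LinearOrder I]

/-- The generator `x i` of `H_I`. -/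
noncomputable def qx (i : I) : QAlg q I :=
  qMk q I (FreeAlgebra.ι ℂ (QGen.x i))

/-- The generator `y i` of `H_I`. -/
noncomputable def qy (i : I) : QAlg q I :=
  qMk q I (FreeAlgebra.ι ℂ (QGen.y i))

theorem qx_mul_qy (i : I) : qx q i * qy q i = q • (qy q i * qx q i) := by
  simpa [qx, qy] using qMk_rel (QRel.xy (q := q) i)

theorem qx_mul_qx {i j : I} (h : i < j) : qx q j * qx q i = q ^ 2 • (qx q i * qx q j) := by
  simpa [qx, qy] using qMk_rel (QRel.xx (q := q) i j h)

theorem qy_mul_qy {i j : I} (h : i < j) : qy q j * qy q i = q ^ 2 • (qy q i * qy q j) := by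
  simpa [qx, qy] using qMk_rel (QRel.yy (q := q) i j h)

theorem qxj_mul_qyi {i j : I} (h : i < j) :
    qx q j * qy q i = q • (qy q i * qx q j) + (q ^ 2 - 1) • (qx q i * qy q j) := by
  simpa only [qx, qy, map_mul, map_add, map_smul] using
    qMk_rel (QRel.xjyi (q := q) i j h)

theorem qyj_mul_qxi {i j : I} (h : i < j) : qy q j * qx q i = q • (qx q i * qy q j) := by
  simpa [qx, qy] using qMk_rel (QRel.yjxi (q := q) i j h)

/-- Algebra homomorphisms out of `H_I` are given by elements satisfying the relations. -/
noncomputable def qLift {R : Type*} [Ring R] [Algebra ℂ R] (X Y : I → R)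
    (hxy : ∀ i, X i * Y i = q • (Y i * X i))
    (hxx : ∀ i j, i < j → X j * X i = q ^ 2 • (X i * X j))
    (hyy : ∀ i j, i < j → Y j * Y i = q ^ 2 • (Y i * Y j))
    (hxjyi : ∀ i j, i < j → X j * Y i = q • (Y i * X j) + (q ^ 2 - 1) • (X i * Y j))
    (hyjxi : ∀ i j, i < j → Y j * X i = q • (X i * Y j)) : QAlg q I →ₐ[ℂ] R :=
  RingQuot.liftAlgHom ℂ
    ⟨FreeAlgebra.lift ℂ (fun g => match g with
      | QGen.x i => X i
      | QGen.y i => Y i), by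
      intro a b h
      cases h with
      | xy i => simpa using hxy i
      | xx i j h => simpa using hxx i j h
      | yy i j h => simpa using hyy i j h
      | xjyi i j h =>
        simpa only [map_mul, map_add, map_smul, FreeAlgebra.lift_ι_apply] using hxjyi i j h
      | yjxi i j h => simpa using hyjxi i j h⟩

end QAlg

theorem root_ne_zero {q s : ℂ} (hs : s ^ 2 = q) (hq : ‖q‖ = 1) : s ≠ 0 := by
  rintro rfl
  rw [← hs] at hq
  simp at hq

/-- Rescaling all the `x i` by `c` and all the `y i` by `d` is an endomorphism of `H_I`. -/
noncomputable def qScale (q c d : ℂ) (I : Type*) [LinearOrder I] : QAlg q I →ₐ[ℂ] QAlg q I :=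
  qLift q (fun i => c • qx q i) (fun i => d • qy q i)
    (by intro i
        simp only [smul_mul_smul_comm, qx_mul_qy, smul_smul]
        ring_nf)
    (by intro i j h
        simp only [smul_mul_smul_comm, qx_mul_qx q h, smul_smul]
        ring_nf)
    (by intro i j h
        simp only [smul_mul_smul_comm, qy_mul_qy q h, smul_smul]
        ring_nf)
    (by intro i j h
        simp only [smul_mul_smul_comm, qxj_mul_qyi q h, smul_smul, smul_add]
        ring_nf)
    (by intro i j h
        simp only [smul_mul_smul_comm, qyj_mul_qxi q h, smul_smul]
        ring_nf)

/-- The action of `K`: the automorphism with `K x_i = q^(-1/2) x_i`, `K y_i = q^(1/2) y_i`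
(here `s = q^(1/2)`). -/
noncomputable def actK (q s : ℂ) (I : Type*) [LinearOrder I] : QAlg q I →ₐ[ℂ] QAlg q I :=
  qScale q s⁻¹ s I

/-- The action of `K⁻¹`. -/
noncomputable def actKinv (q s : ℂ) (I : Type*) [LinearOrder I] : QAlg q I →ₐ[ℂ] QAlg q I :=
  qScale q s s⁻¹ I

/-- The homomorphism `a ↦ !![K⁻¹ a, E a; 0, K a]`, which encodes the rule
`E (a b) = E a * K b + K⁻¹ a * E b`. -/
noncomputable def homE {q s : ℂ} (hs : s ^ 2 = q) (hq : ‖q‖ = 1) (I : Type*) [LinearOrder I] :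
    QAlg q I →ₐ[ℂ] Matrix (Fin 2) (Fin 2) (QAlg q I) :=
  qLift q (fun i => !![s • qx q i, s • qy q i; 0, s⁻¹ • qx q i])
    (fun i => !![s⁻¹ • qy q i, 0; 0, s • qy q i])
    (by
      have h0 := root_ne_zero hs hq
      subst hs
      intro i
      ext a b
      fin_cases a <;> fin_cases b <;>
        simp [Matrix.mul_apply, Fin.sum_univ_two, qx_mul_qy, smul_smul] <;>
        match_scalars <;> field_simp <;> ring)
    (by
      have h0 := root_ne_zero hs hq
      subst hs
      intro i j h
      ext a b
      fin_cases a <;> fin_cases b <;>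
        simp [Matrix.mul_apply, Fin.sum_univ_two, qx_mul_qx _ h, qy_mul_qy _ h, qxj_mul_qyi _ h, qyj_mul_qxi _ h, smul_smul] <;>
        match_scalars <;> field_simp <;> ring)
    (by
      have h0 := root_ne_zero hs hq
      subst hs
      intro i j h
      ext a b
      fin_cases a <;> fin_cases b <;>
        simp [Matrix.mul_apply, Fin.sum_univ_two, qx_mul_qx _ h, qy_mul_qy _ h, qxj_mul_qyi _ h, qyj_mul_qxi _ h, smul_smul] <;>
        match_scalars <;> field_simp <;> ring)
    (by
      have h0 := root_ne_zero hs hq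
      subst hs
      intro i j h
      ext a b
      fin_cases a <;> fin_cases b <;>
        simp [Matrix.mul_apply, Fin.sum_univ_two, qx_mul_qx _ h, qy_mul_qy _ h, qxj_mul_qyi _ h, qyj_mul_qxi _ h, smul_smul] <;>
        match_scalars <;> field_simp <;> ring)
    (by
      have h0 := root_ne_zero hs hq
      subst hs
      intro i j h
      ext a b
      fin_cases a <;> fin_cases b <;>
        simp [Matrix.mul_apply, Fin.sum_univ_two, qx_mul_qx _ h, qy_mul_qy _ h, qxj_mul_qyi _ h, qyj_mul_qxi _ h, smul_smul] <;>
        match_scalars <;> field_simp <;> ring)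

/-- The homomorphism `a ↦ !![K⁻¹ a, F a; 0, K a]`, which encodes the rule
`F (a b) = F a * K b + K⁻¹ a * F b`. -/
noncomputable def homF {q s : ℂ} (hs : s ^ 2 = q) (hq : ‖q‖ = 1) (I : Type*) [LinearOrder I] :
    QAlg q I →ₐ[ℂ] Matrix (Fin 2) (Fin 2) (QAlg q I) :=
  qLift q (fun i => !![s • qx q i, 0; 0, s⁻¹ • qx q i])
    (fun i => !![s⁻¹ • qy q i, s⁻¹ • qx q i; 0, s • qy q i])
    (by
      have h0 := root_ne_zero hs hq
      subst hs
      intro i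
      ext a b
      fin_cases a <;> fin_cases b <;>
        simp [Matrix.mul_apply, Fin.sum_univ_two, qx_mul_qy, smul_smul] <;>
        match_scalars <;> field_simp <;> ring)
    (by
      have h0 := root_ne_zero hs hq
      subst hs
      intro i j h
      ext a b
      fin_cases a <;> fin_cases b <;>
        simp [Matrix.mul_apply, Fin.sum_univ_two, qx_mul_qx _ h, qy_mul_qy _ h, qxj_mul_qyi _ h, qyj_mul_qxi _ h, smul_smul] <;>
        match_scalars <;> field_simp <;> ring)
    (by
      have h0 := root_ne_zero hs hq
      subst hs
      intro i j h
      ext a b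
      fin_cases a <;> fin_cases b <;>
        simp [Matrix.mul_apply, Fin.sum_univ_two, qx_mul_qx _ h, qy_mul_qy _ h, qxj_mul_qyi _ h, qyj_mul_qxi _ h, smul_smul] <;>
        match_scalars <;> field_simp <;> ring)
    (by
      have h0 := root_ne_zero hs hq
      subst hs
      intro i j h
      ext a b
      fin_cases a <;> fin_cases b <;>
        simp [Matrix.mul_apply, Fin.sum_univ_two, qx_mul_qx _ h, qy_mul_qy _ h, qxj_mul_qyi _ h, qyj_mul_qxi _ h, smul_smul] <;>
        match_scalars <;> field_simp <;> ring)
    (by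
      have h0 := root_ne_zero hs hq
      subst hs
      intro i j h
      ext a b
      fin_cases a <;> fin_cases b <;>
        simp [Matrix.mul_apply, Fin.sum_univ_two, qx_mul_qx _ h, qy_mul_qy _ h, qxj_mul_qyi _ h, qyj_mul_qxi _ h, smul_smul] <;>
        match_scalars <;> field_simp <;> ring)

/-- Induction on the elements of `H_I`. -/
theorem qAlg_induction {q : ℂ} {I : Type*} [LinearOrder I] {P : QAlg q I → Prop}
    (hc : ∀ c : ℂ, P (algebraMap ℂ _ c)) (hx : ∀ i, P (qx q i)) (hy : ∀ i, P (qy q i))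
    (hadd : ∀ a b, P a → P b → P (a + b)) (hmul : ∀ a b, P a → P b → P (a * b))
    (a : QAlg q I) : P a := by
  obtain ⟨a, rfl⟩ := qMk_surjective q I a
  induction a using FreeAlgebra.induction with
  | grade0 c => simpa using hc c
  | grade1 g =>
    cases g with
    | x i => exact hx i
    | y i => exact hy i
  | mul a b ha hb => simpa using hmul _ _ ha hb
  | add a b ha hb => simpa using hadd _ _ ha hb

@[simp]
theorem qLift_qx {q : ℂ} {I : Type*} [LinearOrder I] {R : Type*} [Ring R] [Algebra ℂ R]
    (X Y : I → R) (h1) (h2) (h3) (h4) (h5) (i : I) :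
    qLift q X Y h1 h2 h3 h4 h5 (qx q i) = X i := by
  exact (RingQuot.liftAlgHom_mkAlgHom_apply ℂ _ _ _).trans (FreeAlgebra.lift_ι_apply _ _)

@[simp]
theorem qLift_qy {q : ℂ} {I : Type*} [LinearOrder I] {R : Type*} [Ring R] [Algebra ℂ R]
    (X Y : I → R) (h1) (h2) (h3) (h4) (h5) (i : I) :
    qLift q X Y h1 h2 h3 h4 h5 (qy q i) = Y i := by
  exact (RingQuot.liftAlgHom_mkAlgHom_apply ℂ _ _ _).trans (FreeAlgebra.lift_ι_apply _ _)

section ActionEF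

variable {q s : ℂ} (hs : s ^ 2 = q) (hq : ‖q‖ = 1) {I : Type*} [LinearOrder I]

/-- The action of `E` on `H_I`. -/
noncomputable def actE (a : QAlg q I) : QAlg q I := homE hs hq I a 0 1

/-- The action of `F` on `H_I`. -/
noncomputable def actF (a : QAlg q I) : QAlg q I := homF hs hq I a 0 1

theorem actK_qx (i : I) : actK q s I (qx q i) = s⁻¹ • qx q i := by simp [actK, qScale]

theorem actK_qy (i : I) : actK q s I (qy q i) = s • qy q i := by simp [actK, qScale]

theorem actE_qx (i : I) : actE hs hq (qx q i) = s • qy q i := by simp [actE, homE]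

theorem actE_qy (i : I) : actE hs hq (qy q i) = 0 := by simp [actE, homE]

theorem actF_qx (i : I) : actF hs hq (qx q i) = 0 := by simp [actF, homF]

theorem actF_qy (i : I) : actF hs hq (qy q i) = s⁻¹ • qx q i := by simp [actF, homF]

theorem homE_diag (a : QAlg q I) : homE hs hq I a 1 0 = 0 ∧
    homE hs hq I a 0 0 = actKinv q s I a ∧ homE hs hq I a 1 1 = actK q s I a := by
  induction a using qAlg_induction with
  | hc c => simp only [AlgHom.commutes]; simp [Matrix.algebraMap_matrix_apply]
  | hx i => simp [homE, actK, actKinv, qScale]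
  | hy i => simp [homE, actK, actKinv, qScale]
  | hadd a b ha hb => simp [ha, hb]
  | hmul a b ha hb => simp [ha, hb, Matrix.mul_apply, Fin.sum_univ_two]

theorem homF_diag (a : QAlg q I) : homF hs hq I a 1 0 = 0 ∧
    homF hs hq I a 0 0 = actKinv q s I a ∧ homF hs hq I a 1 1 = actK q s I a := by
  induction a using qAlg_induction with
  | hc c => simp only [AlgHom.commutes]; simp [Matrix.algebraMap_matrix_apply]
  | hx i => simp [homF, actK, actKinv, qScale]
  | hy i => simp [homF, actK, actKinv, qScale]
  | hadd a b ha hb => simp [ha, hb]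
  | hmul a b ha hb => simp [ha, hb, Matrix.mul_apply, Fin.sum_univ_two]

theorem actE_mul (a b : QAlg q I) : actE hs hq (a * b) =
    actE hs hq a * actK q s I b + actKinv q s I a * actE hs hq b := by
  simp [actE, Matrix.mul_apply, Fin.sum_univ_two, homE_diag, add_comm]

theorem actF_mul (a b : QAlg q I) : actF hs hq (a * b) =
    actF hs hq a * actK q s I b + actKinv q s I a * actF hs hq b := by
  simp [actF, Matrix.mul_apply, Fin.sum_univ_two, homF_diag, add_comm]

/-- The elements invariant under the action: `E a = F a = 0` and `K a = a`. -/
def IsQInvariant (a : QAlg q I) : Prop :=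
  actE hs hq a = 0 ∧ actF hs hq a = 0 ∧ actK q s I a = a

end ActionEF

/-- The bracket symbol `(ij) = q^(-1/2) x_i y_j - q^(1/2) y_i x_j`, with `s = q^(1/2)`. -/
noncomputable def qBracket (q s : ℂ) {I : Type*} [LinearOrder I] (i j : I) : QAlg q I :=
  s⁻¹ • (qx q i * qy q j) - s • (qy q i * qx q j)

/-- The coefficients `A, B, C` of a quadratic form `x² A + [2] x y B + y² C`. -/
structure QForm (R : Type*) where
  A : R
  B : R
  C : R

/-- The quadratic form `x_o² A + [2] x_o y_o B + y_o² C` in the variables with index `o`,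
where `[2] = q + q⁻¹`. -/
noncomputable def QForm.toElem {q : ℂ} {I : Type*} [LinearOrder I] (o : I)
    (f : QForm (QAlg q I)) : QAlg q I :=
  qx q o ^ 2 * f.A + (q + q⁻¹) • (qx q o * qy q o * f.B) + qy q o ^ 2 * f.C

/-- The coefficients of the quadratic form `f_{ij} = q (oi)(oj)`, for `o < i < j`. -/
noncomputable def pairForm (q : ℂ) {I : Type*} [LinearOrder I] (i j : I) : QForm (QAlg q I) where
  A := q • (qy q i * qy q j)
  B := (q + q⁻¹)⁻¹ • (-(q ^ 2 • (qx q i * qy q j)) - q • (qy q i * qx q j))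
  C := q ^ 3 • (qx q i * qx q j)

/-- `pairForm` gives the coefficients of `q (oi)(oj)`. -/
theorem pairForm_toElem {q s : ℂ} (hs : s ^ 2 = q) (hq : ‖q‖ = 1) (hq2 : q ^ 2 ≠ -1)
    {I : Type*} [LinearOrder I] {o i j : I} (hi : o < i) :
    (pairForm q i j).toElem o = q • (qBracket q s o i * qBracket q s o j) := by
  have h0 := root_ne_zero hs hq
  have hq0 : q ≠ 0 := by rw [← hs]; exact pow_ne_zero 2 h0
  have h2 : q + q⁻¹ ≠ 0 := by
    intro h
    apply hq2
    field_simp at h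
    linear_combination h
  have hs1 : s⁻¹ * s⁻¹ = q⁻¹ := by rw [← hs, sq, mul_inv]
  have hs2 : s * s = q := by rw [← hs, sq]
  have e1 : qx q o * qy q i * (qx q o * qy q j) = q • (qx q o ^ 2 * (qy q i * qy q j)) := by
    rw [mul_assoc, ← mul_assoc (qy q i), qyj_mul_qxi q hi]
    simp [sq, mul_assoc]
  have e2 : qx q o * qy q i * (qy q o * qx q j) =
      q ^ 2 • (qx q o * qy q o * (qy q i * qx q j)) := by
    rw [mul_assoc, ← mul_assoc (qy q i), qy_mul_qy q hi]
    simp [mul_assoc]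
  have e3 : qy q o * qx q i * (qx q o * qy q j) =
      q • (qx q o * qy q o * (qx q i * qy q j)) := by
    rw [mul_assoc, ← mul_assoc (qx q i), qx_mul_qx q hi, qx_mul_qy]
    simp only [mul_assoc, smul_mul_assoc, mul_smul_comm, smul_smul]
    ring_nf
  have e4 : qy q o * qx q i * (qy q o * qx q j) =
      q • (qy q o ^ 2 * (qx q i * qx q j)) +
        ((q ^ 2 - 1) * q⁻¹) • (qx q o * qy q o * (qy q i * qx q j)) := by
    rw [mul_assoc, ← mul_assoc (qx q i), qxj_mul_qyi q hi, qx_mul_qy]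
    simp only [mul_assoc, smul_mul_assoc, mul_smul_comm, smul_smul, add_mul, mul_add, sq]
    rw [inv_mul_cancel₀ hq0, mul_one]
  have e : qBracket q s o i * qBracket q s o j =
      q⁻¹ • (qx q o * qy q i * (qx q o * qy q j)) - qx q o * qy q i * (qy q o * qx q j)
      - qy q o * qx q i * (qx q o * qy q j) + q • (qy q o * qx q i * (qy q o * qx q j)) := by
    simp only [qBracket, sub_mul, mul_sub, smul_mul_smul_comm, hs1, hs2, inv_mul_cancel₀ h0,
      mul_inv_cancel₀ h0, one_smul]
    abel
  rw [e, e1, e2, e3, e4]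
  simp only [QForm.toElem, pairForm, mul_smul_comm, smul_smul, mul_sub, mul_neg]
  rw [mul_inv_cancel₀ h2]
  match_scalars <;> field_simp <;> ring

/-- The coefficients of the Jacobian of the quadratic forms `f` and `g`; the `B`-coefficient is
the coefficient of `x y` divided by `[2] = q + q⁻¹`. -/
noncomputable def qJacobian (q : ℂ) {R : Type*} [Ring R] [Algebra ℂ R] (f g : QForm R) :
    QForm R where
  A := q ^ 9 • (f.A * g.B) - q ^ 7 • (f.B * g.A)
  B := (q + q⁻¹)⁻¹ • (q ^ 7 • (f.A * g.C) - q ^ 7 • (f.C * g.A) + (q ^ 10 - q ^ 6) • (f.B * g.B))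
  C := q ^ 9 • (f.B * g.C) - q ^ 7 • (f.C * g.B)

/-- The combinant of three quadratic forms, with `s = q^(1/2)`. -/
noncomputable def qCombinant (s : ℂ) {R : Type*} [Ring R] [Algebra ℂ R] (f g h : QForm R) : R :=
  s ^ (-5 : ℤ) • (f.A * g.B * h.C) - s ^ (-9 : ℤ) • (f.A * g.C * h.B)
    - s ^ (-9 : ℤ) • (f.B * g.A * h.C) + s ^ (-9 : ℤ) • (f.B * g.C * h.A)
    + s ^ (-9 : ℤ) • (f.C * g.A * h.B) - s ^ (-13 : ℤ) • (f.C * g.B * h.A)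
    - (s ^ (-3 : ℤ) - s ^ (-11 : ℤ)) • (f.B * g.B * h.B)

/-- The Jacobian `J_{f_{ij}, f_{kl}}`. -/
noncomputable def pairJacobian (q : ℂ) {I : Type*} [LinearOrder I] (i j k l : I) :
    QForm (QAlg q I) :=
  qJacobian q (pairForm q i j) (pairForm q k l)

/-- The linear combination `C_{a_1,…,a_12}` (with `a_n` written `a (n - 1)`) of twelve combinants
for the hexagon with the successive vertices `p 1, …, p 6`. -/
noncomputable def pascalCombination (q s : ℂ) {I : Type*} [LinearOrder I] (p : Fin 7 → I)
    (a : Fin 12 → ℂ) : QAlg q I :=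
  let J₁ := pairJacobian q (p 1) (p 2) (p 4) (p 5)
  let J₂ := pairJacobian q (p 2) (p 3) (p 5) (p 6)
  let J₃ := pairJacobian q (p 3) (p 4) (p 1) (p 6)
  let J₄ := pairJacobian q (p 1) (p 6) (p 3) (p 4)
  a 0 • qCombinant s J₁ J₂ J₃ + a 1 • qCombinant s J₂ J₃ J₁ + a 2 • qCombinant s J₃ J₁ J₂
    - a 3 • qCombinant s J₁ J₃ J₂ - a 4 • qCombinant s J₃ J₂ J₁ - a 5 • qCombinant s J₂ J₁ J₃
    - a 6 • qCombinant s J₁ J₂ J₄ - a 7 • qCombinant s J₂ J₄ J₁ - a 8 • qCombinant s J₄ J₁ J₂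
    + a 9 • qCombinant s J₁ J₄ J₂ + a 10 • qCombinant s J₄ J₂ J₁ + a 11 • qCombinant s J₂ J₁ J₄

/-- The common denominator in the two-parameter family. -/
noncomputable def pascalDenom (q : ℂ) : ℂ :=
  q ^ 12 - 4 * q ^ 10 + 4 * q ^ 8 - 6 * q ^ 4 + 6 * q ^ 2 - 2

/-- `a` is the member with parameters `α, β` of the two-parameter family of coefficients. -/
def IsPascalFamily (q α β : ℂ) (a : Fin 12 → ℂ) : Prop :=
  a 0 = α ∧ a 8 = α ∧ a 1 = β ∧ a 7 = β ∧
  a 2 = -q ^ 2 * ((2 * q ^ 8 - 5 * q ^ 6 + 2 * q ^ 4 + 2 * q ^ 2 - 2) / pascalDenom q) * α ∧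
  a 6 = a 2 ∧
  a 3 = 2 * q ^ 2 * ((q ^ 16 - 3 * q ^ 14 + 2 * q ^ 12 + 3 * q ^ 10 - 6 * q ^ 8 + 3 * q ^ 6
      + 2 * q ^ 4 - 3 * q ^ 2 + 1) / pascalDenom q) * α + q ^ 14 * β ∧
  a 9 = a 3 ∧
  a 4 = -(q⁻¹ ^ 4 * ((2 * q ^ 8 - 2 * q ^ 6 - 2 * q ^ 4 + 5 * q ^ 2 - 2) / pascalDenom q)) * α ∧
  a 11 = a 4 ∧
  a 5 = q⁻¹ ^ 6 * ((2 * q ^ 12 - 6 * q ^ 10 + 6 * q ^ 8 - 4 * q ^ 4 + 4 * q ^ 2 - 1)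
      / pascalDenom q) * α ∧
  a 10 = a 5

/-! Invariance is representation theory. The coefficient triple of a form transforms under `K`, `E`,
`F` dually to `x₀²`, `[2] x₀ y₀`, `y₀²` (`IsCovariant`). The forms `f_{ij}` have this property, the
Jacobian preserves it, and the combinant sends three such triples to an invariant, so every linear
combination of combinants is invariant.

Vanishing is linear algebra over `ℤ[q]`. The relations of `H_I` rewrite every product of generators
as a combination of the ordered monomials in `y₁, x₁, y₂, x₂, …`. After multiplication by nonzero
scalars, the twelve combinants become twelve explicit combinations (`pascalTerm`) with coefficients
in `ℤ[q]`. That the family suffices needs only the soundness of the rewriting (`eval_mulY`,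
`eval_mulX`): two relations between the twelve combinations are verified by computation
(`isZero_pascalLinComb`), and they span the family because the denominator `D` has no zero on the
unit circle (`pascalDenom_ne_zero`).

The converse needs the linear independence of the ordered monomials. It comes from a representation
of `H_I` on functions of the exponents, built one index at a time (`extHom`,
`exists_representation`), in which the coefficients of a normal form can be read off
(`exists_coeff_functional`). A vanishing combination then gives one linear equation in the twelve
coefficients for each monomial. Ten certificates combine these equations into ten relations, each
multiplied by an integer and by powers of `q`, `q² + 1`, `q² - 1`, `q⁴ + 1`, `q⁴ - q² + 1`. The
hypotheses make these factors invertible (`sum_target_eq_zero`), and the ten relations leave only `a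
0` and `a 1` free. -/

/-! ### Computable normal forms for elements of `H_I`. -/

/-- Polynomials in noncommuting variables, written in a fixed order of the variables, with
coefficients in `ℤ[q]` given by their lists of coefficients: `const c` is the constant `c`, and
`horner h t` is `h + g * t`, where `g` is the first variable and does not occur in `h`.
The operations below are defined by recursors, because the kernel evaluates these quickly. -/
inductive OrdPoly where
  | const (c : List ℤ) : OrdPoly
  | horner (h t : OrdPoly) : OrdPoly

/-- Addition of coefficient lists. -/
noncomputable def coeffAdd (a : List ℤ) : List ℤ → List ℤ :=
  List.rec (motive := fun _ => List ℤ → List ℤ) (fun b => b)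
    (fun x as ih b => List.rec (motive := fun _ => List ℤ) (x :: as)
      (fun y bs _ => Int.add x y :: ih bs) b) a

/-- The coefficient list of `a + q * b`. -/
noncomputable def coeffAddShift (a b : List ℤ) : List ℤ :=
  List.rec (motive := fun _ => List ℤ) a
    (fun y bs _ => List.rec (motive := fun _ => List ℤ) (0 :: y :: bs)
      (fun x as _ => x :: coeffAdd as (y :: bs)) a) b

/-- Multiplication of the entries of a list by an integer. -/
noncomputable def coeffMap (f : ℤ → ℤ) (b : List ℤ) : List ℤ :=
  List.rec (motive := fun _ => List ℤ) [] (fun y _ ih => f y :: ih) b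

/-- Multiplication of a coefficient list by an integer. -/
noncomputable def coeffScale (z : ℤ) (b : List ℤ) : List ℤ :=
  Int.rec (motive := fun _ => List ℤ)
    (fun n => Nat.rec (motive := fun _ => List ℤ) []
      (fun m _ => Nat.rec (motive := fun _ => List ℤ) b (fun _ _ => coeffMap (Int.mul z) b) m) n)
    (fun n => Nat.rec (motive := fun _ => List ℤ) (coeffMap Int.neg b)
      (fun _ _ => coeffMap (Int.mul z) b) n) z

/-- Multiplication of coefficient lists. -/
noncomputable def coeffMul (a b : List ℤ) : List ℤ :=
  List.rec (motive := fun _ => List ℤ) [] (fun z _ ih => coeffAddShift (coeffScale z b) ih) a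

/-- Whether an integer vanishes. -/
noncomputable def intIsZero (z : ℤ) : Bool :=
  Int.rec (motive := fun _ => Bool) (fun n => Nat.beq n 0) (fun _ => false) z

/-- Whether all coefficients vanish. -/
noncomputable def coeffIsZero (a : List ℤ) : Bool :=
  List.rec (motive := fun _ => Bool) true
    (fun x _ ih => Bool.rec (motive := fun _ => Bool) false ih (intIsZero x)) a

/-- The choice between two polynomials according to whether a coefficient list is empty. -/
noncomputable def ifEmpty (c : List ℤ) (s t : OrdPoly) : OrdPoly :=
  List.rec (motive := fun _ => OrdPoly) s (fun _ _ _ => t) c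

namespace OrdPoly

/-- Adding a constant. -/
noncomputable def addConst (c : List ℤ) (s : OrdPoly) : OrdPoly :=
  OrdPoly.rec (motive := fun _ => OrdPoly) (fun d => const (coeffAdd c d))
    (fun _ t ih _ => horner ih t) s

/-- Left multiplication by the first variable. -/
noncomputable def mulVar (s : OrdPoly) : OrdPoly :=
  OrdPoly.rec (motive := fun _ => OrdPoly)
    (fun d => ifEmpty d (const []) (horner (const []) (const d)))
    (fun h t _ _ => horner (const []) (horner h t)) s

/-- Addition. -/
noncomputable def add (s : OrdPoly) : OrdPoly → OrdPoly :=
  OrdPoly.rec (motive := fun _ => OrdPoly → OrdPoly) (fun c s => ifEmpty c s (addConst c s))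
    (fun h t ih ih' s => OrdPoly.rec (motive := fun _ => OrdPoly)
      (fun d => ifEmpty d (horner h t) (addConst d (horner h t)))
      (fun h' t' _ _ => horner (ih h') (ih' t')) s) s

/-- Multiplication by a scalar. -/
noncomputable def smul (c : List ℤ) (s : OrdPoly) : OrdPoly :=
  OrdPoly.rec (motive := fun _ => OrdPoly) (fun d => const (coeffMul c d))
    (fun _ _ ih ih' => horner ih ih') s

/-- Left multiplication by an element `z` with `z * g = c • (g * z)` for the first variable `g`,
given the left multiplication `F` by `z` on polynomials in the other variables. -/
noncomputable def skip (c : List ℤ) (F : OrdPoly → OrdPoly) (s : OrdPoly) : OrdPoly :=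
  OrdPoly.rec (motive := fun _ => OrdPoly)
    (fun d => ifEmpty d (const []) (horner (F (const d)) (const [])))
    (fun h _ _ ih => horner (F h) (smul c ih)) s

/-- Left multiplication by the variable `x` in position `0`. -/
noncomputable def mulX₀ : OrdPoly → OrdPoly := skip [0, 1] mulVar

/-- Left multiplication by the variable `y` in position `j`. -/
noncomputable def mulY (j : ℕ) : OrdPoly → OrdPoly :=
  Nat.rec (motive := fun _ => OrdPoly → OrdPoly) mulVar
    (fun _ ih => skip [0, 0, 1] (skip [0, 1] ih)) j

/-- Left multiplication by an element `X` with `X * y = q • (y * X) + (q ^ 2 - 1) • (x * Y)` for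
the first two variables `y`, `x`, given the left multiplication `F` by `X` on the polynomials
without `y`, and the left multiplication `G` by `Y`. -/
noncomputable def braidX (F G : OrdPoly → OrdPoly) (s : OrdPoly) : OrdPoly :=
  OrdPoly.rec (motive := fun _ => OrdPoly)
    (fun d => ifEmpty d (const []) (horner (F (const d)) (const [])))
    (fun h t _ ih => add (horner (F h) (smul [0, 1] ih)) (smul [-1, 0, 1] (mulX₀ (G t)))) s

/-- Left multiplication by the variable `x` in position `j`. -/
noncomputable def mulX (j : ℕ) : OrdPoly → OrdPoly :=
  Nat.rec (motive := fun _ => OrdPoly → OrdPoly) mulX₀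
    (fun j ih => braidX (skip [0, 0, 1] ih) (mulY (Nat.succ j))) j

/-- Whether all coefficients vanish. -/
noncomputable def isZero (s : OrdPoly) : Bool :=
  OrdPoly.rec (motive := fun _ => Bool) (fun d => coeffIsZero d)
    (fun _ _ ih ih' => Bool.rec (motive := fun _ => Bool) false ih' ih) s

/-- The constant coefficient. -/
noncomputable def constCoeff (s : OrdPoly) : List ℤ :=
  OrdPoly.rec (motive := fun _ => List ℤ) (fun c => c) (fun _ _ ih _ => ih) s

/-- The factor of the `n`-th power of the first variable. -/
noncomputable def part (s : OrdPoly) : ℕ → OrdPoly :=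
  OrdPoly.rec (motive := fun _ => ℕ → OrdPoly)
    (fun c n => Nat.rec (motive := fun _ => OrdPoly) (const c) (fun _ _ => const []) n)
    (fun h _ _ ih n => Nat.rec (motive := fun _ => OrdPoly) h (fun n _ => ih n) n) s

/-- The coefficient of the monomial with the given list of exponents. -/
noncomputable def coeff (m : List ℕ) : OrdPoly → List ℤ :=
  List.rec (motive := fun _ => OrdPoly → List ℤ) constCoeff (fun n _ ih s => ih (part s n)) m

/-- Left multiplication by the coefficients of `(q + q⁻¹) • f`, for `f` the form of the pair of
the positions `i`, `j`. -/
noncomputable def pairOp (i j : ℕ) : QForm (OrdPoly → OrdPoly) where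
  A t := smul [1, 0, 1] (mulY i (mulY j t))
  B t := add (smul [0, 0, -1] (mulX i (mulY j t))) (smul [0, -1] (mulY i (mulX j t)))
  C t := smul [0, 0, 1, 0, 1] (mulX i (mulX j t))

/-- Left multiplication by the coefficients of the Jacobian, multiplied by
`q⁻¹ ^ 7 * (q ^ 2 + 1)`. -/
noncomputable def jacobianOp (f g : QForm (OrdPoly → OrdPoly)) : QForm (OrdPoly → OrdPoly) where
  A t := add (smul [0, 0, 1, 0, 1] (f.A (g.B t))) (smul [-1, 0, -1] (f.B (g.A t)))
  B t := add (add (smul [0, 1] (f.A (g.C t))) (smul [0, -1] (f.C (g.A t))))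
    (smul [-1, 0, 0, 0, 1] (f.B (g.B t)))
  C t := add (smul [0, 0, 1, 0, 1] (f.B (g.C t))) (smul [-1, 0, -1] (f.C (g.B t)))

/-- The element `J.A * u.A + J.B * u.B + J.C * u.C` for the Jacobian `J` of `f` and `g`, multiplied
by `q⁻¹ ^ 7 * (q ^ 2 + 1)`. -/
noncomputable def jacobianApply (f g : QForm (OrdPoly → OrdPoly)) (u : QForm OrdPoly) : OrdPoly :=
  add (add (f.A (add (smul [0, 0, 1, 0, 1] (g.B u.A)) (smul [0, 1] (g.C u.B))))
    (f.B (add (add (smul [-1, 0, -1] (g.A u.A)) (smul [-1, 0, 0, 0, 1] (g.B u.B)))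
      (smul [0, 0, 1, 0, 1] (g.C u.C)))))
    (f.C (add (smul [0, -1] (g.A u.B)) (smul [-1, 0, -1] (g.B u.C))))

/-- The factors of the coefficients of `f` in the combinant of `f`, `g`, `h`, multiplied by
`s ^ 13`. -/
noncomputable def combinantInner (g h : QForm (OrdPoly → OrdPoly)) : QForm OrdPoly where
  A := add (smul [0, 0, 0, 0, 1] (g.B (h.C (const [1])))) (smul [0, 0, -1] (g.C (h.B (const [1]))))
  B := add (add (smul [0, 0, -1] (g.A (h.C (const [1])))) (smul [0, 0, 1] (g.C (h.A (const [1])))))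
    (smul [0, 1, 0, 0, 0, -1] (g.B (h.B (const [1]))))
  C := add (smul [0, 0, 1] (g.A (h.B (const [1])))) (smul [-1] (g.B (h.A (const [1]))))

/-- Coefficientwise addition of quadratic forms. -/
noncomputable def addForm (u v : QForm OrdPoly) : QForm OrdPoly :=
  ⟨add u.A v.A, add u.B v.B, add u.C v.C⟩

/-- Multiplication of a quadratic form by a scalar. -/
noncomputable def smulForm (c : List ℤ) (u : QForm OrdPoly) : QForm OrdPoly :=
  ⟨smul c u.A, smul c u.B, smul c u.C⟩

end OrdPoly

/-! ### Soundness of the arithmetic of normal forms. -/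

/-- The value at `q` of the polynomial with the given list of coefficients. -/
def coeffEval (q : ℂ) : List ℤ → ℂ
  | [] => 0
  | a :: as => a + q * coeffEval q as

section CoeffEval

variable (q : ℂ)

theorem coeffEval_add (a b : List ℤ) :
    coeffEval q (coeffAdd a b) = coeffEval q a + coeffEval q b := by
  induction a generalizing b with
  | nil => exact (zero_add _).symm
  | cons x as ih =>
    cases b with
    | nil => exact (add_zero _).symm
    | cons y bs =>
      change ((x + y : ℤ) : ℂ) + q * coeffEval q (coeffAdd as bs) = _
      rw [ih, coeffEval, coeffEval]
      push_cast
      ring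

theorem coeffEval_addShift (a b : List ℤ) :
    coeffEval q (coeffAddShift a b) = coeffEval q a + q * coeffEval q b := by
  cases b with
  | nil =>
    change coeffEval q a = _
    simp [coeffEval]
  | cons y bs =>
    cases a with
    | nil =>
      change ((0 : ℤ) : ℂ) + q * coeffEval q (y :: bs) = _
      simp [coeffEval]
    | cons x as =>
      change (x : ℂ) + q * coeffEval q (coeffAdd as (y :: bs)) = _
      rw [coeffEval_add]
      simp only [coeffEval]
      ring

theorem coeffEval_map (f : ℤ → ℤ) (c : ℂ) (hf : ∀ z, ((f z : ℤ) : ℂ) = c * z) (b : List ℤ) :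
    coeffEval q (coeffMap f b) = c * coeffEval q b := by
  induction b with
  | nil => exact (mul_zero _).symm
  | cons y bs ih =>
    change ((f y : ℤ) : ℂ) + q * coeffEval q (coeffMap f bs) = _
    rw [ih, hf, coeffEval]
    ring

theorem coeffEval_scale (z : ℤ) (b : List ℤ) :
    coeffEval q (coeffScale z b) = z * coeffEval q b := by
  have hmul : ∀ w : ℤ, coeffEval q (coeffMap (Int.mul w) b) = w * coeffEval q b := fun w =>
    coeffEval_map q _ w (fun z => by rw [← Int.cast_mul]; rfl) b
  match z with
  | Int.ofNat 0 =>
    change (0 : ℂ) = _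
    simp
  | Int.ofNat 1 =>
    change coeffEval q b = _
    simp
  | Int.ofNat (n + 2) => exact hmul _
  | Int.negSucc 0 =>
    change coeffEval q (coeffMap Int.neg b) = _
    rw [coeffEval_map q _ (-1) (fun z => by rw [neg_one_mul, ← Int.cast_neg]; rfl)]
    simp
  | Int.negSucc (n + 1) => exact hmul _

theorem coeffEval_mul (a b : List ℤ) :
    coeffEval q (coeffMul a b) = coeffEval q a * coeffEval q b := by
  induction a with
  | nil => exact (zero_mul _).symm
  | cons z as ih =>
    change coeffEval q (coeffAddShift (coeffScale z b) (coeffMul as b)) = _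
    rw [coeffEval_addShift, coeffEval_scale, ih, coeffEval]
    ring

theorem coeffEval_eq_zero {a : List ℤ} (h : coeffIsZero a = true) : coeffEval q a = 0 := by
  induction a with
  | nil => rfl
  | cons x as ih =>
    match x with
    | Int.ofNat 0 =>
      have h' : coeffIsZero as = true := h
      simp [coeffEval, ih h']
    | Int.ofNat (n + 1) => exact absurd h (by change ¬ (false = true); simp)
    | Int.negSucc n => exact absurd h (by change ¬ (false = true); simp)

end CoeffEval

namespace OrdPoly

section Eval

variable (q : ℂ) {R : Type*} [Ring R] [Algebra ℂ R]

/-- The value of an ordered polynomial, for a list of values of the variables. -/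
def eval : OrdPoly → List R → R
  | const c, _ => algebraMap ℂ R (coeffEval q c)
  -- When the variables run out, the remaining variables count as zero; with this default the rules
  -- for sums and scalars hold for every list.
  | horner h _, [] => eval h []
  | horner h t, g :: gs => eval h gs + g * eval t (g :: gs)

@[simp]
theorem eval_const_nil (gs : List R) : eval q (const []) gs = 0 := by
  simp [eval, coeffEval]

theorem eval_ifEmpty_left (c : List ℤ) (s : OrdPoly) (gs : List R) (z : R)
    (h : eval q s gs = z) (h0 : c = [] → z = 0) : eval q (ifEmpty c (const []) s) gs = z := by
  cases c with
  | nil => exact (eval_const_nil q gs).trans (h0 rfl).symm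
  | cons => exact h

theorem eval_addConst (c : List ℤ) (s : OrdPoly) (gs : List R) :
    eval q (addConst c s) gs = algebraMap ℂ R (coeffEval q c) + eval q s gs := by
  induction s generalizing gs with
  | const d =>
    change algebraMap ℂ R (coeffEval q (coeffAdd c d)) = _
    rw [coeffEval_add, map_add, eval]
  | horner h t ih _ =>
    change eval q (horner (addConst c h) t) gs = _
    cases gs with
    | nil => rw [eval, eval, ih]
    | cons g gs => rw [eval, eval, ih, add_assoc]

theorem eval_ifEmpty_addConst (c : List ℤ) (s : OrdPoly) (gs : List R) :
    eval q (ifEmpty c s (addConst c s)) gs = algebraMap ℂ R (coeffEval q c) + eval q s gs := by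
  cases c with
  | nil =>
    change eval q s gs = _
    simp [coeffEval]
  | cons => exact eval_addConst q _ s gs

theorem eval_add (s t : OrdPoly) (gs : List R) :
    eval q (add s t) gs = eval q s gs + eval q t gs := by
  induction s generalizing t gs with
  | const c => exact eval_ifEmpty_addConst q c t gs
  | horner h t' ih ih' =>
    cases t with
    | const d =>
      exact (eval_ifEmpty_addConst q d (horner h t') gs).trans (add_comm _ _)
    | horner k u =>
      change eval q (horner (add h k) (add t' u)) gs = _
      cases gs with
      | nil => simp only [eval, ih]
      | cons g gs =>
        simp only [eval, ih, ih', mul_add]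
        abel

theorem eval_smul (c : List ℤ) (s : OrdPoly) (gs : List R) :
    eval q (smul c s) gs = coeffEval q c • eval q s gs := by
  induction s generalizing gs with
  | const d =>
    change algebraMap ℂ R (coeffEval q (coeffMul c d)) = _
    rw [coeffEval_mul, map_mul, eval, Algebra.smul_def]
  | horner h t ih ih' =>
    change eval q (horner (smul c h) (smul c t)) gs = _
    cases gs with
    | nil => simp only [eval, ih]
    | cons g gs => simp only [eval, ih, ih', smul_add, mul_smul_comm]

/-- Only this direction is needed to prove vanishing, so the sufficiency of the family does not
depend on the independence of the ordered monomials. -/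
theorem eval_eq_zero {s : OrdPoly} (h : isZero s = true) (gs : List R) : eval q s gs = 0 := by
  induction s generalizing gs with
  | const c =>
    have h' : coeffIsZero c = true := h
    rw [eval, coeffEval_eq_zero q h', map_zero]
  | horner s t ih ih' =>
    have h' : (Bool.rec (motive := fun _ => Bool) false (isZero t) (isZero s)) = true := h
    have hs : isZero s = true := by
      cases hs : isZero s with
      | true => rfl
      | false => rw [hs] at h'; exact h'
    have ht : isZero t = true := by
      rw [hs] at h'; exact h'
    cases gs with
    | nil => rw [eval, ih hs]
    | cons g gs => rw [eval, ih hs, ih' ht, mul_zero, add_zero]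

theorem eval_mulVar (s : OrdPoly) (g : R) (gs : List R) :
    eval q (mulVar s) (g :: gs) = g * eval q s (g :: gs) := by
  cases s with
  | const d =>
    refine eval_ifEmpty_left q d _ _ _ ?_ ?_
    · simp [eval, coeffEval]
    · rintro rfl
      simp
  | horner h t =>
    change eval q (horner (const []) (horner h t)) (g :: gs) = _
    rw [eval, eval_const_nil, zero_add]

/-- With `z g = c g z`, the product `z (h + g t)` is `z h + c g (z t)`; the factor `z h` does not
involve `g`, so `F` handles it, and `z t` is the recursive call. -/
theorem eval_skip (c : List ℤ) (F : OrdPoly → OrdPoly) (z g : R) (gs : List R)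
    (hz : z * g = coeffEval q c • (g * z)) (hF : ∀ s, eval q (F s) gs = z * eval q s gs)
    (s : OrdPoly) : eval q (skip c F s) (g :: gs) = z * eval q s (g :: gs) := by
  induction s with
  | const d =>
    refine eval_ifEmpty_left q d _ _ _ ?_ ?_
    · simp [eval, hF, coeffEval]
    · rintro rfl
      simp
  | horner h t _ ih =>
    change eval q (horner (F h) (smul c (skip c F t))) (g :: gs) = _
    rw [eval, eval_smul, ih, hF, eval, mul_add, ← mul_assoc z, hz]
    simp only [smul_mul_assoc, mul_smul_comm, mul_assoc]

theorem eval_mulX₀ (x y : R) (gs : List R) (h : x * y = q • (y * x)) (s : OrdPoly) :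
    eval q (mulX₀ s) (y :: x :: gs) = x * eval q s (y :: x :: gs) :=
  eval_skip q _ _ _ _ _ (by simpa [coeffEval] using h) (fun s => eval_mulVar q s x gs) s

/-- The product `X (h + y t)` is `X h + q y (X t) + (q² - 1) x (Y t)`. The first two terms form a
Horner pair; the last is normalized by moving `Y` and then `x` into place. -/
theorem eval_braidX (F G : OrdPoly → OrdPoly) (x y X Y : R) (gs : List R)
    (hxy : x * y = q • (y * x)) (hX : X * y = q • (y * X) + (q ^ 2 - 1) • (x * Y))
    (hF : ∀ s, eval q (F s) (x :: gs) = X * eval q s (x :: gs))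
    (hG : ∀ s, eval q (G s) (y :: x :: gs) = Y * eval q s (y :: x :: gs)) (s : OrdPoly) :
    eval q (braidX F G s) (y :: x :: gs) = X * eval q s (y :: x :: gs) := by
  induction s with
  | const d =>
    refine eval_ifEmpty_left q d _ _ _ ?_ ?_
    · simp [eval, hF, coeffEval]
    · rintro rfl
      simp
  | horner h t _ ih =>
    change eval q (add (horner (F h) (smul [0, 1] (braidX F G t)))
      (smul [-1, 0, 1] (mulX₀ (G t)))) (y :: x :: gs) = _
    rw [eval_add, eval, eval_smul, ih, hF, eval_smul, eval_mulX₀ q x y gs hxy, hG, eval, mul_add,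
      ← mul_assoc X y, hX]
    simp only [coeffEval, smul_mul_assoc, mul_smul_comm, mul_assoc, add_mul, add_assoc]
    congr 3
    · simp
    · push_cast
      ring

end Eval

section Generators

variable (q : ℂ) {I : Type*} [LinearOrder I]

/-- The list of the generators `y i`, `x i` for the indices `i` in a list. -/
noncomputable def generators (L : List I) : List (QAlg q I) :=
  L.flatMap fun i => [qy q i, qx q i]

theorem generators_cons (i : I) (L : List I) :
    generators q (i :: L) = qy q i :: qx q i :: generators q L := rfl

theorem eval_mulY {L : List I} (hL : L.Pairwise (· < ·)) {j : ℕ} {i : I} (hi : L[j]? = some i)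
    (s : OrdPoly) :
    eval q (mulY j s) (generators q L) = qy q i * eval q s (generators q L) := by
  induction L generalizing j s with
  | nil => simp at hi
  | cons k L ih =>
    rw [generators_cons]
    cases j with
    | zero =>
      obtain rfl : k = i := by simpa using hi
      exact eval_mulVar q s _ _
    | succ j =>
      have hi' : L[j]? = some i := by simpa using hi
      have hk : k < i := (List.pairwise_cons.1 hL).1 i (List.mem_of_getElem? hi')
      refine eval_skip q _ _ _ _ _ ?_ (eval_skip q _ _ _ _ _ ?_ fun s => ih hL.of_cons hi' s) s
      · rw [qy_mul_qy q hk]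
        simp [coeffEval, sq]
      · rw [qyj_mul_qxi q hk]
        simp [coeffEval]

/-- Moving `x i` past an earlier `y k` produces a `y i`, so the recursion calls `mulY` on the full
list, whereas `mulY` never calls `mulX`. -/
theorem eval_mulX {L : List I} (hL : L.Pairwise (· < ·)) {j : ℕ} {i : I} (hi : L[j]? = some i)
    (s : OrdPoly) :
    eval q (mulX j s) (generators q L) = qx q i * eval q s (generators q L) := by
  induction L generalizing j s with
  | nil => simp at hi
  | cons k L ih =>
    cases j with
    | zero =>
      obtain rfl : k = i := by simpa using hi
      exact eval_mulX₀ q _ _ _ (qx_mul_qy q k) s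
    | succ j =>
      have hi' : L[j]? = some i := by simpa using hi
      have hk : k < i := (List.pairwise_cons.1 hL).1 i (List.mem_of_getElem? hi')
      refine eval_braidX q (skip [0, 0, 1] (mulX j)) (mulY (j + 1)) _ _ _ (qy q i) _
        (qx_mul_qy q k) (qxj_mul_qyi q hk) (eval_skip q _ _ _ _ _ ?_ fun s => ih hL.of_cons hi' s)
        (eval_mulY q hL hi) s
      rw [qx_mul_qx q hk]
      simp [coeffEval, sq]

end Generators

end OrdPoly

/-! ### Adjoining an earlier pair of generators to a representation. -/

section Extension

variable (q : ℂ) {V : Type*} [AddCommGroup V] [Module ℂ V]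

/-- Left multiplication by `y` on the polynomials `∑ y ^ b * x ^ a * φ b a`. -/
def extY : Module.End ℂ (ℕ → ℕ → V) where
  toFun φ b a := match b with
    | 0 => 0
    | b + 1 => φ b a
  map_add' φ ψ := by
    funext b a
    cases b <;> simp
  map_smul' c φ := by
    funext b a
    cases b <;> simp

/-- Left multiplication by `x` on the polynomials `∑ y ^ b * x ^ a * φ b a`, with
`x * y = q • (y * x)`. -/
def extX : Module.End ℂ (ℕ → ℕ → V) where
  toFun φ b a := match a with
    | 0 => 0
    | a + 1 => q ^ b • φ b a
  map_add' φ ψ := by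
    funext b a
    cases a <;> simp
  map_smul' c φ := by
    funext b a
    cases a <;> simp [smul_comm c]

/-- Left multiplication by a later `y`-generator on the polynomials `∑ y ^ b * x ^ a * φ b a`, for
its action `Y` on the coefficients. -/
def extBraidY (Y : Module.End ℂ V) : Module.End ℂ (ℕ → ℕ → V) where
  toFun φ b a := q ^ (a + 2 * b) • Y (φ b a)
  map_add' φ ψ := by
    funext b a
    simp
  map_smul' c φ := by
    funext b a
    simp [smul_comm c]

/-- Left multiplication by a later `x`-generator on the polynomials `∑ y ^ b * x ^ a * φ b a`, for
the actions `X` and `Y` of the later generators on the coefficients. -/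
def extBraidX (X Y : Module.End ℂ V) : Module.End ℂ (ℕ → ℕ → V) where
  toFun φ b a := q ^ (2 * a + b) • X (φ b a) + match a with
    | 0 => 0
    -- By induction on `n`, `X yⁿ = qⁿ yⁿ X + q^(n-1) (q^(2n) - 1) y^(n-1) x Y`. Taking `n = b + 1`
    -- and moving `Y` past `x^a`, which costs `q^a`, gives this contribution of `φ (b + 1) a` to the
    -- monomial `y^b x^(a+1)`.
    | a + 1 => (q ^ (a + b) * (q ^ (2 * b + 2) - 1)) • Y (φ (b + 1) a)
  map_add' φ ψ := by
    funext b a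
    cases a <;> simp
    abel
  map_smul' c φ := by
    funext b a
    cases a <;> simp [smul_comm c]

@[simp] theorem extY_zero (φ : ℕ → ℕ → V) (a : ℕ) : extY φ 0 a = 0 := rfl

@[simp] theorem extY_succ (φ : ℕ → ℕ → V) (b a : ℕ) : extY φ (b + 1) a = φ b a := rfl

@[simp] theorem extX_zero (φ : ℕ → ℕ → V) (b : ℕ) : extX q φ b 0 = 0 := rfl

@[simp] theorem extX_succ (φ : ℕ → ℕ → V) (b a : ℕ) : extX q φ b (a + 1) = q ^ b • φ b a := rfl

@[simp] theorem extBraidY_apply (Y : Module.End ℂ V) (φ : ℕ → ℕ → V) (b a : ℕ) :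
    extBraidY q Y φ b a = q ^ (a + 2 * b) • Y (φ b a) := rfl

@[simp] theorem extBraidX_zero (X Y : Module.End ℂ V) (φ : ℕ → ℕ → V) (b : ℕ) :
    extBraidX q X Y φ b 0 = q ^ b • X (φ b 0) := by
  simp [extBraidX]

@[simp] theorem extBraidX_succ (X Y : Module.End ℂ V) (φ : ℕ → ℕ → V) (b a : ℕ) :
    extBraidX q X Y φ b (a + 1) = q ^ (2 * (a + 1) + b) • X (φ b (a + 1)) +
      (q ^ (a + b) * (q ^ (2 * b + 2) - 1)) • Y (φ (b + 1) a) := rfl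

/-- This and the following relations are compared on each coefficient; the case splits isolate the
exponents for which a shift gives zero. -/
theorem extX_mul_extY : extX q * extY = q • (extY * extX q : Module.End ℂ (ℕ → ℕ → V)) := by
  ext φ b a
  rcases b with _ | b <;> rcases a with _ | a <;> simp [smul_smul, pow_succ']

theorem extBraidY_mul_extY (Y : Module.End ℂ V) :
    extBraidY q Y * extY = q ^ 2 • (extY * extBraidY q Y) := by
  ext φ b a
  rcases b with _ | b <;> simp [smul_smul]
  ring_nf

theorem extBraidY_mul_extX (Y : Module.End ℂ V) :
    extBraidY q Y * extX q = q • (extX q * extBraidY q Y) := by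
  ext φ b a
  rcases a with _ | a <;> simp [smul_smul]
  ring_nf

theorem extBraidX_mul_extX (X Y : Module.End ℂ V) :
    extBraidX q X Y * extX q = q ^ 2 • (extX q * extBraidX q X Y) := by
  ext φ b a
  rcases a with _ | _ | a <;> simp [smul_smul] <;> match_scalars <;> ring

theorem extBraidX_mul_extY (X Y : Module.End ℂ V) : extBraidX q X Y * extY =
    q • (extY * extBraidX q X Y) + (q ^ 2 - 1) • (extX q * extBraidY q Y) := by
  ext φ b a
  rcases b with _ | b <;> rcases a with _ | a <;> simp [smul_smul] <;> match_scalars <;> ring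

variable {q} {X Y X' Y' : Module.End ℂ V}

/-- From here on both generators are later than the adjoined pair: the operators inherit the
relations that hold between the actions on `V`. -/
theorem extBraidX_mul_extBraidY (h : X * Y = q • (Y * X)) :
    extBraidX q X Y * extBraidY q Y = q • (extBraidY q Y * extBraidX q X Y) := by
  have h' : ∀ v, X (Y v) = q • Y (X v) := fun v => LinearMap.congr_fun h v
  ext φ b a
  rcases a with _ | a <;> simp [smul_smul, h'] <;> match_scalars <;> ring

theorem extBraidY_mul_extBraidY (h : Y' * Y = q ^ 2 • (Y * Y')) :
    extBraidY q Y' * extBraidY q Y = q ^ 2 • (extBraidY q Y * extBraidY q Y') := by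
  have h' : ∀ v, Y' (Y v) = q ^ 2 • Y (Y' v) := fun v => LinearMap.congr_fun h v
  ext φ b a
  simp [smul_smul, h']
  ring_nf

theorem extBraidY_mul_extBraidX (h : Y' * X = q • (X * Y')) (h2 : Y' * Y = q ^ 2 • (Y * Y')) :
    extBraidY q Y' * extBraidX q X Y = q • (extBraidX q X Y * extBraidY q Y') := by
  have h' : ∀ v, Y' (X v) = q • X (Y' v) := fun v => LinearMap.congr_fun h v
  have h2' : ∀ v, Y' (Y v) = q ^ 2 • Y (Y' v) := fun v => LinearMap.congr_fun h2 v
  ext φ b a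
  rcases a with _ | a <;> simp [smul_smul, h', h2'] <;> match_scalars <;> ring

theorem extBraidX_mul_extBraidY' (h : X' * Y = q • (Y * X') + (q ^ 2 - 1) • (X * Y'))
    (h2 : Y' * Y = q ^ 2 • (Y * Y')) : extBraidX q X' Y' * extBraidY q Y =
      q • (extBraidY q Y * extBraidX q X' Y') +
        (q ^ 2 - 1) • (extBraidX q X Y * extBraidY q Y') := by
  have h' : ∀ v, X' (Y v) = q • Y (X' v) + (q ^ 2 - 1) • X (Y' v) :=
    fun v => LinearMap.congr_fun h v
  have h2' : ∀ v, Y' (Y v) = q ^ 2 • Y (Y' v) := fun v => LinearMap.congr_fun h2 v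
  ext φ b a
  rcases a with _ | a <;> simp [smul_smul, h', h2'] <;> match_scalars <;> ring

theorem extBraidX_mul_extBraidX (h : X' * X = q ^ 2 • (X * X'))
    (hxy : X' * Y = q • (Y * X') + (q ^ 2 - 1) • (X * Y')) (hyx : Y' * X = q • (X * Y'))
    (hyy : Y' * Y = q ^ 2 • (Y * Y')) :
    extBraidX q X' Y' * extBraidX q X Y = q ^ 2 • (extBraidX q X Y * extBraidX q X' Y') := by
  have h' : ∀ v, X' (X v) = q ^ 2 • X (X' v) := fun v => LinearMap.congr_fun h v
  have hxy' : ∀ v, X' (Y v) = q • Y (X' v) + (q ^ 2 - 1) • X (Y' v) :=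
    fun v => LinearMap.congr_fun hxy v
  have hyx' : ∀ v, Y' (X v) = q • X (Y' v) := fun v => LinearMap.congr_fun hyx v
  have hyy' : ∀ v, Y' (Y v) = q ^ 2 • Y (Y' v) := fun v => LinearMap.congr_fun hyy v
  ext φ b a
  -- Each of the two operators can raise the exponent of `x` by one, so the exponents `0` and `1`
  -- are both boundary cases.
  rcases a with _ | _ | a <;> simp [smul_smul, h', hxy', hyx', hyy'] <;> match_scalars <;> ring

end Extension

/-! ### Independence of the ordered monomials. -/

section Coefficients

open OrdPoly

variable (q : ℂ) {V : Type*} [AddCommGroup V] [Module ℂ V]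

@[simp] theorem extBraidX_zero_zero : extBraidX q (0 : Module.End ℂ V) 0 = 0 := by
  ext φ b a
  cases a <;> simp

@[simp] theorem extBraidY_zero' : extBraidY q (0 : Module.End ℂ V) = 0 := by
  ext φ b a
  simp

/-- The constant polynomial `∑ y ^ b * x ^ a * φ b a` with value `v`. -/
def extConst (v : V) : ℕ → ℕ → V
  | 0, 0 => v
  | 0, _ + 1 => 0
  | _ + 1, _ => 0

/-- The correction term of `extBraidX` trades a factor `y` for a factor `x`; a constant has no `y`
to trade. -/
theorem extBraidX_extConst (X Y : Module.End ℂ V) (v : V) :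
    extBraidX q X Y (extConst v) = extConst (X v) := by
  funext b a
  rcases b with _ | b <;> rcases a with _ | a <;> simp [extConst]

theorem extBraidY_extConst (Y : Module.End ℂ V) (v : V) :
    extBraidY q Y (extConst v) = extConst (Y v) := by
  funext b a
  rcases b with _ | b <;> rcases a with _ | a <;> simp [extConst]

theorem extConst_add {V : Type*} [AddCommGroup V] (v w : V) : extConst (v + w) = extConst v + extConst w := by
  funext b a
  rcases b with _ | b <;> rcases a with _ | a <;> simp [extConst]

theorem extConst_smul (c : ℂ) (v : V) : extConst (c • v) = c • extConst v := by
  funext b a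
  rcases b with _ | b <;> rcases a with _ | a <;> simp [extConst]

variable {q} {I : Type*} [LinearOrder I]

/-- The representation of `H_I` on the polynomials in `x k`, `y k` with coefficients in a
representation on which the generators with indices up to `k` vanish. -/
noncomputable def extHom (ρ : QAlg q I →ₐ[ℂ] Module.End ℂ V) (k : I)
    (hx : ∀ i ≤ k, ρ (qx q i) = 0) (hy : ∀ i ≤ k, ρ (qy q i) = 0) :
    QAlg q I →ₐ[ℂ] Module.End ℂ (ℕ → ℕ → V) :=
  qLift q (fun i => if i = k then extX q else extBraidX q (ρ (qx q i)) (ρ (qy q i)))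
    (fun i => if i = k then extY else extBraidY q (ρ (qy q i)))
    (by
      intro i
      split_ifs with h
      · exact extX_mul_extY q
      · exact extBraidX_mul_extBraidY (by rw [← map_mul, qx_mul_qy, map_smul, map_mul]))
    (by
      intro i j hij
      by_cases hi : i = k
      · rw [if_pos hi, if_neg (by rintro rfl; exact hij.ne hi)]
        exact extBraidX_mul_extX q _ _
      · rw [if_neg hi]
        by_cases hj : j = k
        -- Here `i < k`, so both generators with index `i` act by zero and both sides vanish.
        · simp [hx i (hj ▸ hij.le), hy i (hj ▸ hij.le)]
        · rw [if_neg hj]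
          apply extBraidX_mul_extBraidX <;>
            simp only [← map_mul, ← map_smul, ← map_add, qx_mul_qx q hij, qxj_mul_qyi q hij,
              qyj_mul_qxi q hij, qy_mul_qy q hij])
    (by
      intro i j hij
      by_cases hi : i = k
      · rw [if_pos hi, if_neg (by rintro rfl; exact hij.ne hi)]
        exact extBraidY_mul_extY q _
      · rw [if_neg hi]
        by_cases hj : j = k
        · simp [hy i (hj ▸ hij.le)]
        · rw [if_neg hj]
          apply extBraidY_mul_extBraidY
          simp only [← map_mul, ← map_smul, qy_mul_qy q hij])
    (by
      intro i j hij
      by_cases hi : i = k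
      · simp only [if_pos hi, if_neg (show j ≠ k by rintro rfl; exact hij.ne hi)]
        exact extBraidX_mul_extY q _ _
      · simp only [if_neg hi]
        by_cases hj : j = k
        · simp [hx i (hj ▸ hij.le), hy i (hj ▸ hij.le)]
        · simp only [if_neg hj]
          apply extBraidX_mul_extBraidY' <;>
            simp only [← map_mul, ← map_smul, ← map_add, qxj_mul_qyi q hij, qy_mul_qy q hij])
    (by
      intro i j hij
      by_cases hi : i = k
      · rw [if_pos hi, if_neg (by rintro rfl; exact hij.ne hi)]
        exact extBraidY_mul_extX q _
      · rw [if_neg hi]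
        by_cases hj : j = k
        · simp [hx i (hj ▸ hij.le), hy i (hj ▸ hij.le)]
        · rw [if_neg hj]
          apply extBraidY_mul_extBraidX <;>
            simp only [← map_mul, ← map_smul, qyj_mul_qxi q hij, qy_mul_qy q hij])

section

variable (ρ : QAlg q I →ₐ[ℂ] Module.End ℂ V) (k : I)
    (hx : ∀ i ≤ k, ρ (qx q i) = 0) (hy : ∀ i ≤ k, ρ (qy q i) = 0)

theorem extHom_eval_of_forall (gs : List (QAlg q I))
    (hg : ∀ g ∈ gs, ∀ v, extHom ρ k hx hy g (extConst v) = extConst (ρ g v)) (s : OrdPoly)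
    (v : V) : extHom ρ k hx hy (eval q s gs) (extConst v) = extConst (ρ (eval q s gs) v) := by
  induction s generalizing gs with
  | const c =>
    simp only [eval, AlgHom.commutes, Module.algebraMap_end_apply, extConst_smul]
  | horner h t ih ih' =>
    cases gs with
    | nil => exact ih [] hg
    | cons g gs =>
      simp only [eval, map_add, map_mul, LinearMap.add_apply, Module.End.mul_apply, extConst_add]
      rw [ih gs fun g' hg' => hg g' (List.mem_cons_of_mem _ hg'), ih' _ hg,
        hg g List.mem_cons_self]

theorem extHom_eval_generators {L : List I} (hL : ∀ i ∈ L, k < i) (s : OrdPoly) (v : V) :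
    extHom ρ k hx hy (eval q s (generators q L)) (extConst v) =
      extConst (ρ (eval q s (generators q L)) v) := by
  apply extHom_eval_of_forall
  intro g hg v
  obtain ⟨i, hi, hg⟩ := List.mem_flatMap.1 hg
  have hik : i ≠ k := (hL i hi).ne'
  rcases List.mem_cons.1 hg with rfl | hg
  · simp [extHom, hik, extBraidY_extConst]
  · obtain rfl := List.mem_singleton.1 hg
    simp [extHom, hik, extBraidX_extConst]

/-- Without `y k`, the result is concentrated in `b = 0`, and each Horner step in `x k` shifts the
exponent `a` by one, as `part` does. -/
theorem extHom_eval_x {L : List I} (hL : ∀ i ∈ L, k < i) (s : OrdPoly) (v : V) :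
    extHom ρ k hx hy (eval q s (qx q k :: generators q L)) (extConst v) =
      fun b a => if b = 0 then ρ (eval q (part s a) (generators q L)) v else 0 := by
  induction s with
  | const c =>
    funext b a
    rcases b with _ | b <;> rcases a with _ | a <;>
      simp [eval, part, extConst, coeffEval, Module.algebraMap_end_apply]
  | horner h t _ ih =>
    rw [eval, map_add, map_mul, LinearMap.add_apply, Module.End.mul_apply, ih,
      extHom_eval_generators ρ k hx hy hL]
    funext b a
    rcases b with _ | b <;> rcases a with _ | a <;> simp [part, extConst, extHom]

/-- Applied to a constant, a normal form reproduces its own coefficients: the terms in later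
generators act through `ρ`, and left multiplication by `y k` is a pure shift of `b`. -/
theorem extHom_eval {L : List I} (hL : ∀ i ∈ L, k < i) (s : OrdPoly) (v : V) (b a : ℕ) :
    extHom ρ k hx hy (eval q s (generators q (k :: L))) (extConst v) b a =
      ρ (eval q (part (part s b) a) (generators q L)) v := by
  rw [generators_cons]
  induction s generalizing b with
  | const c =>
    rcases b with _ | b <;> rcases a with _ | a <;>
      simp [eval, part, extConst, coeffEval, Module.algebraMap_end_apply]
  | horner h t _ ih =>
    rw [eval, map_add, map_mul, LinearMap.add_apply, Module.End.mul_apply,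
      extHom_eval_x ρ k hx hy hL]
    rcases b with _ | b
    · simp [part, extHom]
    · have := ih b
      simp only [part] at this ⊢
      simp [← this, extHom]

end

/-- Induction from the last index to the first. That the generators outside the list act by zero is
carried along because `extHom` requires it for the indices up to `k`; since the list is increasing,
none of these occurs in its tail. -/
theorem exists_representation {L : List I} (hL : L.Pairwise (· < ·)) :
    ∃ (V : Type) (_ : AddCommGroup V) (_ : Module ℂ V) (ρ : QAlg q I →ₐ[ℂ] Module.End ℂ V)
      (v : V), (∀ i ∉ L, ρ (qx q i) = 0 ∧ ρ (qy q i) = 0) ∧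
      ∀ m : List ℕ, m.length = 2 * L.length → ∃ ℓ : V →ₗ[ℂ] ℂ,
        ∀ s, ℓ (ρ (eval q s (generators q L)) v) = coeffEval q (coeff m s) := by
  induction L with
  | nil =>
    -- With no indices left, all generators act by zero on `ℂ`, and only the constant coefficient
    -- survives.
    refine ⟨ℂ, inferInstance, inferInstance, qLift q (fun _ => 0) (fun _ => 0) (by simp) (by simp)
      (by simp) (by simp) (by simp), 1, by simp, ?_⟩
    intro m hm
    obtain rfl : m = [] := by simpa using hm
    refine ⟨LinearMap.id, fun s => ?_⟩
    have : ∀ s, eval q s ([] : List (QAlg q I)) =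
        algebraMap ℂ _ (coeffEval q (constCoeff s)) := by
      intro s
      induction s with
      | const c => rfl
      | horner h t ih _ => exact ih
    change _ = coeffEval q (constCoeff s)
    simp [generators, this, Module.algebraMap_end_apply]
  | cons k L ih =>
    obtain ⟨V, _, _, ρ, v, h0, h⟩ := ih hL.of_cons
    have hk : ∀ i ∈ L, k < i := (List.pairwise_cons.1 hL).1
    have hL' : ∀ i ≤ k, i ∉ L := fun i hi hiL => (hk i hiL).not_ge hi
    refine ⟨ℕ → ℕ → V, inferInstance, inferInstance, extHom ρ k (fun i hi => (h0 i (hL' i hi)).1)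
      (fun i hi => (h0 i (hL' i hi)).2), extConst v, ?_, ?_⟩
    · intro i hi
      rw [List.mem_cons, not_or] at hi
      simp [extHom, hi.1, h0 i hi.2]
    · intro m hm
      match m, hm with
      | b :: a :: m, hm =>
        obtain ⟨ℓ, hℓ⟩ := h m (by simp at hm; omega)
        refine ⟨ℓ ∘ₗ LinearMap.proj a ∘ₗ LinearMap.proj b, fun s => ?_⟩
        refine Eq.trans ?_ (hℓ (part (part s b) a))
        exact congrArg ℓ (extHom_eval ρ k _ _ hk s v b a)
      | [_], hm => simp at hm; omega
      | [], hm => simp at hm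

/-- The coefficients of the elements of `H_I` with respect to the ordered monomials in the
generators with indices in `L`. -/
theorem exists_coeff_functional {L : List I} (hL : L.Pairwise (· < ·)) {m : List ℕ}
    (hm : m.length = 2 * L.length) : ∃ ℓ : QAlg q I →ₗ[ℂ] ℂ,
      ∀ s, ℓ (eval q s (generators q L)) = coeffEval q (coeff m s) := by
  obtain ⟨V, _, _, ρ, v, -, h⟩ := exists_representation (q := q) hL
  obtain ⟨ℓ, hℓ⟩ := h m hm
  exact ⟨ℓ ∘ₗ LinearMap.applyₗ v ∘ₗ ρ.toLinearMap, hℓ⟩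

end Coefficients

/-! ### Forms, Jacobians and combinants as operators on normal forms. -/

section Represents

open OrdPoly

variable {q : ℂ} {I : Type*} [LinearOrder I]

/-- The operators `F` are the left multiplications by the coefficients of `c • f`. -/
structure Represents (q : ℂ) (L : List I) (c : ℂ) (F : QForm (OrdPoly → OrdPoly))
    (f : QForm (QAlg q I)) : Prop where
  A : ∀ s, eval q (F.A s) (generators q L) = c • (f.A * eval q s (generators q L))
  B : ∀ s, eval q (F.B s) (generators q L) = c • (f.B * eval q s (generators q L))
  C : ∀ s, eval q (F.C s) (generators q L) = c • (f.C * eval q s (generators q L))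

/-- The factor `q + q⁻¹` cancels the denominator of the `B`-coefficient, so that all scalars lie in
`ℤ[q]`. -/
theorem represents_pairOp (hq0 : q ≠ 0) (h2 : q + q⁻¹ ≠ 0) {L : List I}
    (hL : L.Pairwise (· < ·)) {m n : ℕ} {i j : I} (hi : L[m]? = some i) (hj : L[n]? = some j) :
    Represents q L (q + q⁻¹) (pairOp m n) (pairForm q i j) := by
  have e : q + q⁻¹ = (q ^ 2 + 1) * q⁻¹ := by field_simp
  have h2' : q ^ 2 + 1 ≠ 0 := by
    intro h
    rw [e, h, zero_mul] at h2
    exact h2 rfl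
  constructor <;> intro s <;>
    simp only [pairOp, pairForm, eval_add, eval_smul, eval_mulX q hL hi, eval_mulX q hL hj,
      eval_mulY q hL hi, eval_mulY q hL hj, coeffEval, smul_mul_assoc, mul_assoc, sub_mul, neg_mul,
      e] <;>
    match_scalars <;> field_simp <;> ring

theorem represents_jacobianOp (hq0 : q ≠ 0) (h2 : q + q⁻¹ ≠ 0) {L : List I} {c d : ℂ}
    {F G : QForm (OrdPoly → OrdPoly)} {f g : QForm (QAlg q I)} (hF : Represents q L c F f)
    (hG : Represents q L d G g) :
    Represents q L (c * d * (q⁻¹ ^ 7 * (q ^ 2 + 1))) (jacobianOp F G) (qJacobian q f g) := by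
  have e : q + q⁻¹ = (q ^ 2 + 1) * q⁻¹ := by field_simp
  have h2' : q ^ 2 + 1 ≠ 0 := by
    intro h
    rw [e, h, zero_mul] at h2
    exact h2 rfl
  constructor <;> intro s <;>
    simp only [jacobianOp, qJacobian, eval_add, eval_smul, hF.A, hF.B, hF.C, hG.A, hG.B, hG.C,
      coeffEval, smul_mul_assoc, mul_assoc, sub_mul, add_mul, mul_smul_comm, e] <;>
    match_scalars <;> field_simp <;> ring

/-- This is distributivity. Grouping by the coefficients of `f` makes each left multiplication by
them run once, instead of once for every product in which they occur. -/
theorem eval_jacobianApply (hq0 : q ≠ 0) (h2 : q + q⁻¹ ≠ 0) {L : List I} {c d : ℂ}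
    {F G : QForm (OrdPoly → OrdPoly)} {f g : QForm (QAlg q I)} (hF : Represents q L c F f)
    (hG : Represents q L d G g) (u : QForm OrdPoly) :
    eval q (jacobianApply F G u) (generators q L) = (c * d * (q⁻¹ ^ 7 * (q ^ 2 + 1))) •
      ((qJacobian q f g).A * eval q u.A (generators q L) +
        (qJacobian q f g).B * eval q u.B (generators q L) +
        (qJacobian q f g).C * eval q u.C (generators q L)) := by
  have e : q + q⁻¹ = (q ^ 2 + 1) * q⁻¹ := by field_simp
  have h2' : q ^ 2 + 1 ≠ 0 := by
    intro h
    rw [e, h, zero_mul] at h2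
    exact h2 rfl
  simp only [jacobianApply, qJacobian, eval_add, eval_smul, hF.A, hF.B, hF.C, hG.A, hG.B, hG.C,
    coeffEval, smul_mul_assoc, mul_assoc, sub_mul, add_mul, mul_smul_comm, mul_add, e]
  match_scalars <;> field_simp <;> ring

/-- The exponents of `s` in the combinant are odd and at least `-13`, so `s ^ 13` turns all of them
into nonnegative powers of `q = s ^ 2`. -/
theorem qCombinant_eq_combinantInner {s : ℂ} (hs : s ^ 2 = q) (hs0 : s ≠ 0) {L : List I} {d e : ℂ}
    {G H : QForm (OrdPoly → OrdPoly)} {f g h : QForm (QAlg q I)}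
    (hG : Represents q L d G g) (hH : Represents q L e H h) :
    f.A * eval q (combinantInner G H).A (generators q L) +
      f.B * eval q (combinantInner G H).B (generators q L) +
      f.C * eval q (combinantInner G H).C (generators q L) =
    (d * e * s ^ 13) • qCombinant s f g h := by
  subst hs
  have h1 : eval (s ^ 2) (const [1]) (generators (s ^ 2) L) = 1 := by simp [eval, coeffEval]
  have z5 : s ^ (-5 : ℤ) = s ^ 8 * (s ^ 13)⁻¹ := by
    rw [zpow_neg]; field_simp
  have z9 : s ^ (-9 : ℤ) = s ^ 4 * (s ^ 13)⁻¹ := by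
    rw [zpow_neg]; field_simp
  have z13 : s ^ (-13 : ℤ) = (s ^ 13)⁻¹ := by
    rw [zpow_neg]; norm_cast
  have z3 : s ^ (-3 : ℤ) = s ^ 10 * (s ^ 13)⁻¹ := by
    rw [zpow_neg]; field_simp
  have z11 : s ^ (-11 : ℤ) = s ^ 2 * (s ^ 13)⁻¹ := by
    rw [zpow_neg]; field_simp
  simp only [combinantInner, qCombinant, eval_add, eval_smul, hG.A, hG.B, hG.C,
    hH.A, hH.B, hH.C, h1, coeffEval, mul_add, mul_smul_comm, mul_one, mul_assoc,
    z5, z9, z13, z3, z11]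
  match_scalars <;> field_simp <;> ring

end Represents

/-! ### Covariance of forms and invariance of combinants. -/

section Invariance

variable {q s : ℂ} (hs : s ^ 2 = q) (hq : ‖q‖ = 1) {I : Type*} [LinearOrder I]

theorem actE_add (a b : QAlg q I) : actE hs hq (a + b) = actE hs hq a + actE hs hq b := by
  simp [actE]

theorem actE_sub (a b : QAlg q I) : actE hs hq (a - b) = actE hs hq a - actE hs hq b := by
  simp [actE]

theorem actE_neg (a : QAlg q I) : actE hs hq (-a) = -actE hs hq a := by
  simp [actE]

theorem actE_smul (c : ℂ) (a : QAlg q I) : actE hs hq (c • a) = c • actE hs hq a := by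
  simp [actE]

theorem actF_add (a b : QAlg q I) : actF hs hq (a + b) = actF hs hq a + actF hs hq b := by
  simp [actF]

theorem actF_sub (a b : QAlg q I) : actF hs hq (a - b) = actF hs hq a - actF hs hq b := by
  simp [actF]

theorem actF_neg (a : QAlg q I) : actF hs hq (-a) = -actF hs hq a := by
  simp [actF]

theorem actF_smul (c : ℂ) (a : QAlg q I) : actF hs hq (c • a) = c • actF hs hq a := by
  simp [actF]

theorem actKinv_qx (i : I) : actKinv q s I (qx q i) = s • qx q i := by simp [actKinv, qScale]

theorem actKinv_qy (i : I) : actKinv q s I (qy q i) = s⁻¹ • qy q i := by simp [actKinv, qScale]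

/-- The coefficients of `f` transform under `K`, `E`, `F` in the way that makes the quadratic form
invariant. -/
structure IsCovariant (f : QForm (QAlg q I)) : Prop where
  KA : actK q s I f.A = q • f.A
  KB : actK q s I f.B = f.B
  KC : actK q s I f.C = q⁻¹ • f.C
  KinvA : actKinv q s I f.A = q⁻¹ • f.A
  KinvB : actKinv q s I f.B = f.B
  KinvC : actKinv q s I f.C = q • f.C
  EA : actE hs hq f.A = 0
  EB : actE hs hq f.B = -(q • f.A)
  EC : actE hs hq f.C = -((q ^ 2 * (q + q⁻¹)) • f.B)
  FA : actF hs hq f.A = -((q⁻¹ * (q + q⁻¹)) • f.B)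
  FB : actF hs hq f.B = -((q⁻¹ ^ 2) • f.C)
  FC : actF hs hq f.C = 0

/-- This reflects that `f_{ij}` is a product of two invariant brackets; it is checked directly on
the generators. The action of `K⁻¹` is recorded too, because the product rules for `E` and `F`
involve it. -/
theorem isCovariant_pairForm (hq4 : q ^ 2 ≠ -1) (i j : I) :
    IsCovariant hs hq (pairForm q i j) := by
  have hs0 := root_ne_zero hs hq
  have h2 : s ^ 4 + 1 ≠ 0 := by
    intro h
    apply hq4
    rw [← hs]
    linear_combination h
  have e : (s ^ 2 + (s ^ 2)⁻¹) = (s ^ 4 + 1) * (s ^ 2)⁻¹ := by field_simp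
  subst hs
  constructor <;>
    simp only [pairForm, map_mul, map_smul, map_sub, map_neg, actK_qx, actK_qy, actKinv_qx,
      actKinv_qy, actE_mul, actE_smul, actE_sub, actE_neg, actE_qx, actE_qy, actF_mul, actF_smul,
      actF_sub, actF_neg, actF_qx, actF_qy, e, smul_mul_assoc, mul_smul_comm, zero_mul, mul_zero]
    <;> match_scalars <;> field_simp <;> ring

variable {hs hq}

/-- The Jacobian is an equivariant map from products of two triples to triples of the same kind; the
twisted product rules reduce this to identities between scalars. -/
theorem IsCovariant.qJacobian (hq4 : q ^ 2 ≠ -1) {f g : QForm (QAlg q I)}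
    (hf : IsCovariant hs hq f) (hg : IsCovariant hs hq g) :
    IsCovariant hs hq (qJacobian q f g) := by
  have hs0 := root_ne_zero hs hq
  have hq0 : q ≠ 0 := by rw [← hs]; exact pow_ne_zero 2 hs0
  have h2 : q ^ 2 + 1 ≠ 0 := fun h => hq4 (by linear_combination h)
  have e : (q + q⁻¹) = (q ^ 2 + 1) * q⁻¹ := by field_simp
  constructor <;>
    simp only [_root_.qJacobian, map_mul, map_smul, map_sub, map_add, actE_mul, actE_smul, actE_sub,
      actE_add, actF_mul, actF_smul, actF_sub, actF_add, hf.KA, hf.KB, hf.KC, hf.KinvA, hf.KinvB,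
      hf.KinvC, hf.EA, hf.EB, hf.EC, hf.FA, hf.FB, hf.FC, hg.KA, hg.KB, hg.KC, hg.KinvA, hg.KinvB,
      hg.KinvC, hg.EA, hg.EB, hg.EC, hg.FA, hg.FB, hg.FC, e, smul_mul_assoc, mul_smul_comm,
      zero_mul, mul_zero, neg_mul, mul_neg]
    <;> match_scalars <;> field_simp <;> ring

/-- The combinant is the invariant pairing of three covariant triples: under `E` and `F` the
contributions to each product of three coefficients cancel, and the weights under `K` cancel in each
term. -/
theorem IsCovariant.isQInvariant_qCombinant (hq4 : q ^ 2 ≠ -1) {f g h : QForm (QAlg q I)}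
    (hf : IsCovariant hs hq f) (hg : IsCovariant hs hq g) (hh : IsCovariant hs hq h) :
    IsQInvariant hs hq (qCombinant s f g h) := by
  have hs0 := root_ne_zero hs hq
  have e : (s ^ 2 + (s ^ 2)⁻¹) = (s ^ 4 + 1) * (s ^ 2)⁻¹ := by field_simp
  subst hs
  refine ⟨?_, ?_, ?_⟩ <;>
    simp only [qCombinant, map_mul, map_smul, map_sub, map_add, actE_mul, actE_smul, actE_sub,
      actE_add, actF_mul, actF_smul, actF_sub, actF_add, hf.KA, hf.KB, hf.KC, hf.KinvA, hf.KinvB,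
      hf.KinvC, hf.EA, hf.EB, hf.EC, hf.FA, hf.FB, hf.FC, hg.KA, hg.KB, hg.KC, hg.KinvA, hg.KinvB,
      hg.KinvC, hg.EA, hg.EB, hg.EC, hg.FA, hg.FB, hg.FC, hh.KA, hh.KB, hh.KC,
      hh.EA, hh.EB, hh.EC, hh.FA, hh.FB, hh.FC, e, smul_mul_assoc, mul_smul_comm,
      zero_mul, mul_zero, neg_mul, mul_neg, add_mul, mul_add, mul_assoc]
    <;> match_scalars <;> field_simp <;> ring

theorem IsQInvariant.add {a b : QAlg q I} (ha : IsQInvariant hs hq a) (hb : IsQInvariant hs hq b) :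
    IsQInvariant hs hq (a + b) :=
  ⟨by rw [actE_add, ha.1, hb.1, add_zero], by rw [actF_add, ha.2.1, hb.2.1, add_zero],
    by rw [map_add, ha.2.2, hb.2.2]⟩

theorem IsQInvariant.sub {a b : QAlg q I} (ha : IsQInvariant hs hq a) (hb : IsQInvariant hs hq b) :
    IsQInvariant hs hq (a - b) :=
  ⟨by rw [actE_sub, ha.1, hb.1, sub_zero], by rw [actF_sub, ha.2.1, hb.2.1, sub_zero],
    by rw [map_sub, ha.2.2, hb.2.2]⟩

theorem IsQInvariant.smul {a : QAlg q I} (ha : IsQInvariant hs hq a) (c : ℂ) :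
    IsQInvariant hs hq (c • a) :=
  ⟨by rw [actE_smul, ha.1, smul_zero], by rw [actF_smul, ha.2.1, smul_zero],
    by rw [map_smul, ha.2.2]⟩

theorem isQInvariant_pascalCombination (hq4 : q ^ 2 ≠ -1) (p : Fin 7 → I) (a : Fin 12 → ℂ) :
    IsQInvariant hs hq (pascalCombination q s p a) := by
  have hJ : ∀ i j k l : I, IsCovariant hs hq (pairJacobian q i j k l) := fun i j k l =>
    (isCovariant_pairForm hs hq hq4 i j).qJacobian hq4 (isCovariant_pairForm hs hq hq4 k l)
  have hC : ∀ (i j k l i' j' k' l' i'' j'' k'' l'' : I) (c : ℂ), IsQInvariant hs hq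
      (c • qCombinant s (pairJacobian q i j k l) (pairJacobian q i' j' k' l')
        (pairJacobian q i'' j'' k'' l'')) := fun _ _ _ _ _ _ _ _ _ _ _ _ c =>
    ((hJ _ _ _ _).isQInvariant_qCombinant hq4 (hJ _ _ _ _) (hJ _ _ _ _)).smul c
  exact ((((((((((((hC _ _ _ _ _ _ _ _ _ _ _ _ _).add (hC _ _ _ _ _ _ _ _ _ _ _ _ _)).add
    (hC _ _ _ _ _ _ _ _ _ _ _ _ _)).sub (hC _ _ _ _ _ _ _ _ _ _ _ _ _)).sub
    (hC _ _ _ _ _ _ _ _ _ _ _ _ _)).sub (hC _ _ _ _ _ _ _ _ _ _ _ _ _)).sub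
    (hC _ _ _ _ _ _ _ _ _ _ _ _ _)).sub (hC _ _ _ _ _ _ _ _ _ _ _ _ _)).sub
    (hC _ _ _ _ _ _ _ _ _ _ _ _ _)).add (hC _ _ _ _ _ _ _ _ _ _ _ _ _)).add
    (hC _ _ _ _ _ _ _ _ _ _ _ _ _)).add (hC _ _ _ _ _ _ _ _ _ _ _ _ _))

end Invariance

/-! ### The twelve combinants of the hexagon in normal form. -/

namespace OrdPoly

/-- The first of the two forms in the Jacobians of the hexagon. -/
noncomputable def hexagonFst : Fin 4 → QForm (OrdPoly → OrdPoly) :=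
  -- Position `n` in the list of vertices is `p (n + 1)`; the entries here and in `hexagonSnd` give
  -- `J₁`, `J₂`, `J₃`, `J₄`.
  ![pairOp 0 1, pairOp 1 2, pairOp 2 3, pairOp 0 5]

/-- The second of the two forms in the Jacobians of the hexagon. -/
noncomputable def hexagonSnd : Fin 4 → QForm (OrdPoly → OrdPoly) :=
  ![pairOp 3 4, pairOp 4 5, pairOp 0 5, pairOp 2 3]

/-- The factors of the coefficients of `f` in the combinant of a form `f` and two of the Jacobians
of the hexagon, up to a scalar. -/
noncomputable def hexagonInner (j k : Fin 4) : QForm OrdPoly :=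
  combinantInner (jacobianOp (hexagonFst j) (hexagonSnd j))
    (jacobianOp (hexagonFst k) (hexagonSnd k))

/-- Left multiplication by one of the Jacobians of the hexagon, up to a scalar. -/
noncomputable def hexagonApply (i : Fin 4) (u : QForm OrdPoly) : OrdPoly :=
  jacobianApply (hexagonFst i) (hexagonSnd i) u

/-- The twelve combinants in `pascalCombination` with their signs, up to a scalar. -/
noncomputable def pascalTerm : Fin 12 → OrdPoly :=
  ![hexagonApply 0 (hexagonInner 1 2), hexagonApply 1 (hexagonInner 2 0),
    hexagonApply 2 (hexagonInner 0 1), smul [-1] (hexagonApply 0 (hexagonInner 2 1)),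
    smul [-1] (hexagonApply 2 (hexagonInner 1 0)), smul [-1] (hexagonApply 1 (hexagonInner 0 2)),
    smul [-1] (hexagonApply 0 (hexagonInner 1 3)), smul [-1] (hexagonApply 1 (hexagonInner 3 0)),
    smul [-1] (hexagonApply 3 (hexagonInner 0 1)), hexagonApply 0 (hexagonInner 3 1),
    hexagonApply 3 (hexagonInner 1 0), hexagonApply 1 (hexagonInner 0 3)]

/-- A linear combination of the terms of `pascalCombination`. -/
noncomputable def pascalLinComb (c : Fin 12 → List ℤ) : OrdPoly :=
  -- The terms are grouped by their first Jacobian, so that only four outer multiplications have to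
  -- be evaluated.
  add
    (add
      (hexagonApply 0 (addForm
        (addForm (smulForm (c 0) (hexagonInner 1 2))
          (smulForm (coeffScale (-1) (c 3)) (hexagonInner 2 1)))
        (addForm (smulForm (coeffScale (-1) (c 6)) (hexagonInner 1 3))
          (smulForm (c 9) (hexagonInner 3 1)))))
      (hexagonApply 1 (addForm
        (addForm (smulForm (c 1) (hexagonInner 2 0))
          (smulForm (coeffScale (-1) (c 5)) (hexagonInner 0 2)))
        (addForm (smulForm (coeffScale (-1) (c 7)) (hexagonInner 3 0))
          (smulForm (c 11) (hexagonInner 0 3))))))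
    (add
      (hexagonApply 2 (addForm (smulForm (c 2) (hexagonInner 0 1))
        (smulForm (coeffScale (-1) (c 4)) (hexagonInner 1 0))))
      (hexagonApply 3 (addForm (smulForm (coeffScale (-1) (c 8)) (hexagonInner 0 1))
        (smulForm (c 10) (hexagonInner 1 0)))))

end OrdPoly

section Hexagon

open OrdPoly

variable {q : ℂ} {I : Type*} [LinearOrder I]

/-- The vertices of the hexagon. -/
def hexagon (p : Fin 7 → I) : List I := [p 1, p 2, p 3, p 4, p 5, p 6]

theorem hexagon_pairwise {p : Fin 7 → I} (hp : StrictMono p) :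
    (hexagon p).Pairwise (· < ·) := by
  have h : ∀ i j : Fin 7, i < j → p i < p j := fun i j h => hp h
  simp only [hexagon, List.pairwise_cons, List.mem_cons, List.not_mem_nil, or_false,
    forall_eq_or_imp, forall_eq, List.Pairwise.nil, and_true, IsEmpty.forall_iff, implies_true]
  refine ⟨⟨?_, ?_, ?_, ?_, ?_⟩, ⟨?_, ?_, ?_, ?_⟩, ⟨?_, ?_, ?_⟩, ⟨?_, ?_⟩, ?_⟩ <;>
    exact h _ _ (by decide)

/-- The scalar by which the operators of the Jacobians differ from the Jacobians. -/
noncomputable def jacobianScale (q : ℂ) : ℂ :=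
  (q + q⁻¹) * (q + q⁻¹) * (q⁻¹ ^ 7 * (q ^ 2 + 1))

theorem add_inv_ne_zero (hq0 : q ≠ 0) (hq4 : q ^ 2 ≠ -1) : q + q⁻¹ ≠ 0 := by
  intro h
  apply hq4
  field_simp at h
  linear_combination h

theorem jacobianScale_ne_zero (hq0 : q ≠ 0) (hq4 : q ^ 2 ≠ -1) : jacobianScale q ≠ 0 := by
  have h2 := add_inv_ne_zero hq0 hq4
  have h3 : q ^ 2 + 1 ≠ 0 := fun h => hq4 (by linear_combination h)
  unfold jacobianScale
  positivity

/-- The Jacobians of the hexagon. -/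
noncomputable def hexagonJacobian (q : ℂ) (p : Fin 7 → I) : Fin 4 → QForm (QAlg q I) :=
  ![pairJacobian q (p 1) (p 2) (p 4) (p 5), pairJacobian q (p 2) (p 3) (p 5) (p 6),
    pairJacobian q (p 3) (p 4) (p 1) (p 6), pairJacobian q (p 1) (p 6) (p 3) (p 4)]

theorem exists_represents_hexagon (hq0 : q ≠ 0) (hq4 : q ^ 2 ≠ -1) {p : Fin 7 → I}
    (hp : StrictMono p) (i : Fin 4) :
    ∃ f g, Represents q (hexagon p) (q + q⁻¹) (hexagonFst i) f ∧
      Represents q (hexagon p) (q + q⁻¹) (hexagonSnd i) g ∧ qJacobian q f g = hexagonJacobian q p i := by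
  have h2 := add_inv_ne_zero hq0 hq4
  have hL := hexagon_pairwise hp
  fin_cases i
  -- The positions are literals, so looking up the vertices and comparing the Jacobians are
  -- definitional computations.
  all_goals exact ⟨_, _, represents_pairOp hq0 h2 hL rfl rfl, represents_pairOp hq0 h2 hL rfl rfl, rfl⟩

theorem eval_hexagonApply (hq0 : q ≠ 0) (hq4 : q ^ 2 ≠ -1) {p : Fin 7 → I} (hp : StrictMono p)
    (i : Fin 4) (u : QForm OrdPoly) :
    eval q (hexagonApply i u) (generators q (hexagon p)) = jacobianScale q •
      ((hexagonJacobian q p i).A * eval q u.A (generators q (hexagon p)) +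
        (hexagonJacobian q p i).B * eval q u.B (generators q (hexagon p)) +
        (hexagonJacobian q p i).C * eval q u.C (generators q (hexagon p))) := by
  obtain ⟨f, g, hf, hg, h⟩ := exists_represents_hexagon hq0 hq4 hp i
  rw [← h]
  exact eval_jacobianApply hq0 (add_inv_ne_zero hq0 hq4) hf hg u

theorem eval_hexagonApply_hexagonInner {s : ℂ} (hs : s ^ 2 = q) (hs0 : s ≠ 0) (hq4 : q ^ 2 ≠ -1)
    {p : Fin 7 → I} (hp : StrictMono p) (i j k : Fin 4) :
    eval q (hexagonApply i (hexagonInner j k)) (generators q (hexagon p)) =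
      (jacobianScale q ^ 3 * s ^ 13) • qCombinant s (hexagonJacobian q p i)
        (hexagonJacobian q p j) (hexagonJacobian q p k) := by
  have hq0 : q ≠ 0 := hs ▸ pow_ne_zero 2 hs0
  have h2 := add_inv_ne_zero hq0 hq4
  have hr : ∀ j, Represents q (hexagon p) (jacobianScale q)
      (jacobianOp (hexagonFst j) (hexagonSnd j)) (hexagonJacobian q p j) := by
    intro j
    obtain ⟨f, g, hf, hg, h⟩ := exists_represents_hexagon hq0 hq4 hp j
    exact h ▸ represents_jacobianOp hq0 h2 hf hg
  rw [eval_hexagonApply hq0 hq4 hp, hexagonInner, qCombinant_eq_combinantInner hs hs0 (hr j) (hr k),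
    smul_smul]
  congr 1
  ring

/-- Three Jacobians contribute the cube and the combinant contributes `s ^ 13`. The scalar is
nonzero, so vanishing can be tested on the normal forms. -/
theorem smul_pascalCombination {s : ℂ} (hs : s ^ 2 = q) (hs0 : s ≠ 0) (hq4 : q ^ 2 ≠ -1)
    {p : Fin 7 → I} (hp : StrictMono p) (a : Fin 12 → ℂ) :
    (jacobianScale q ^ 3 * s ^ 13) • pascalCombination q s p a =
      ∑ i, a i • eval q (pascalTerm i) (generators q (hexagon p)) := by
  have hsmul : ∀ t, eval q (smul [-1] t) (generators q (hexagon p)) =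
      -eval q t (generators q (hexagon p)) := by
    intro t
    rw [eval_smul]
    simp [coeffEval]
  simp only [Fin.sum_univ_succ, Finset.univ_eq_empty, Finset.sum_empty, add_zero]
  simp only [pascalTerm, Matrix.cons_val_zero, Matrix.cons_val_succ, hsmul,
    eval_hexagonApply_hexagonInner hs hs0 hq4 hp]
  change (jacobianScale q ^ 3 * s ^ 13) • pascalCombination q s p a = a 0 • _ + (a 1 • _ + (a 2 • _ +
    (a 3 • _ + (a 4 • _ + (a 5 • _ + (a 6 • _ + (a 7 • _ + (a 8 • _ + (a 9 • _ + (a 10 • _ +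
    a 11 • _))))))))))
  simp only [pascalCombination, hexagonJacobian, Matrix.cons_val]
  module

theorem eval_pascalLinComb (hq0 : q ≠ 0) (hq4 : q ^ 2 ≠ -1) {p : Fin 7 → I} (hp : StrictMono p)
    (c : Fin 12 → List ℤ) :
    eval q (pascalLinComb c) (generators q (hexagon p)) =
      ∑ i, coeffEval q (c i) • eval q (pascalTerm i) (generators q (hexagon p)) := by
  simp only [Fin.sum_univ_succ, Finset.univ_eq_empty, Finset.sum_empty, add_zero]
  simp only [pascalTerm, Matrix.cons_val_zero, Matrix.cons_val_succ, pascalLinComb, addForm,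
    smulForm, eval_add, eval_smul, eval_hexagonApply hq0 hq4 hp, coeffEval_scale, mul_add,
    mul_smul_comm]
  simp only [Fin.succ_zero_eq_one, coeffEval]
  change _ = coeffEval q (c 0) • _ + (coeffEval q (c 1) • _ + (coeffEval q (c 2) • _ +
    (coeffEval q (c 3) • _ + (coeffEval q (c 4) • _ + (coeffEval q (c 5) • _ +
    (coeffEval q (c 6) • _ + (coeffEval q (c 7) • _ + (coeffEval q (c 8) • _ +
    (coeffEval q (c 9) • _ + (coeffEval q (c 10) • _ + coeffEval q (c 11) • _))))))))))
  module

end Hexagon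

/-! ### The two-parameter family gives zero. -/

/-- The entries of the family with `α = q ^ 6 * pascalDenom q` and `β = 0`. -/
def pascalAlpha : Fin 12 → List ℤ :=
  -- The factor `q ^ 6 * pascalDenom q` clears the denominator `D` and the powers `q⁻⁴`, `q⁻⁶`.
  ![[0, 0, 0, 0, 0, 0, -2, 0, 6, 0, -6, 0, 0, 0, 4, 0, -4, 0, 1], [],
    [0, 0, 0, 0, 0, 0, 0, 0, 2, 0, -2, 0, -2, 0, 5, 0, -2],
    [0, 0, 0, 0, 0, 0, 0, 0, 2, 0, -6, 0, 4, 0, 6, 0, -12, 0, 6, 0, 4, 0, -6, 0, 2],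
    [0, 0, 2, 0, -5, 0, 2, 0, 2, 0, -2], [-1, 0, 4, 0, -4, 0, 0, 0, 6, 0, -6, 0, 2],
    [0, 0, 0, 0, 0, 0, 0, 0, 2, 0, -2, 0, -2, 0, 5, 0, -2], [],
    [0, 0, 0, 0, 0, 0, -2, 0, 6, 0, -6, 0, 0, 0, 4, 0, -4, 0, 1],
    [0, 0, 0, 0, 0, 0, 0, 0, 2, 0, -6, 0, 4, 0, 6, 0, -12, 0, 6, 0, 4, 0, -6, 0, 2],
    [-1, 0, 4, 0, -4, 0, 0, 0, 6, 0, -6, 0, 2], [0, 0, 2, 0, -5, 0, 2, 0, 2, 0, -2]]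

/-- The entries of the family with `α = 0` and `β = 1`. -/
def pascalBeta : Fin 12 → List ℤ :=
  ![[], [1], [], [0, 0, 0, 0, 0, 0, 0, 0, 0, 0, 0, 0, 0, 0, 1], [], [], [], [1], [],
    [0, 0, 0, 0, 0, 0, 0, 0, 0, 0, 0, 0, 0, 0, 1], [], []]

/-- The computational core of the sufficiency: two identities between ordered polynomials over
`ℤ[q]`, checked once for all `q` by evaluating the normal forms. -/
theorem isZero_pascalLinComb :
    ((OrdPoly.pascalLinComb pascalBeta).isZero && (OrdPoly.pascalLinComb pascalAlpha).isZero) =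
      true := by
  decide +kernel

section Denominator

variable {q : ℂ}

/-- On the unit circle conjugation is inversion, so a zero of `D` would also be a zero of its
reciprocal polynomial. The two polynomials are coprime. -/
theorem pascalDenom_ne_zero (hq : ‖q‖ = 1) : pascalDenom q ≠ 0 := by
  intro h
  unfold pascalDenom at h
  have hc := congrArg (starRingEnd ℂ) h
  simp only [map_sub, map_add, map_mul, map_pow, map_ofNat, map_zero] at hc
  have h1 : q * starRingEnd ℂ q = 1 := by
    rw [Complex.mul_conj, Complex.normSq_eq_norm_sq, hq]
    norm_num
  generalize starRingEnd ℂ q = c at hc h1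
  have hn : ∀ n, q ^ n * c ^ n = 1 := fun n => by rw [← mul_pow, h1, one_pow]
  have hr : 1 - 4 * q ^ 2 + 4 * q ^ 4 - 6 * q ^ 8 + 6 * q ^ 10 - 2 * q ^ 12 = 0 := by
    -- Multiplying the conjugate equation by `q ^ 12` and cancelling `q ^ n * c ^ n = 1` turns it
    -- into the reciprocal polynomial in `q`.
    linear_combination q ^ 12 * hc - hn 12 + 4 * q ^ 2 * hn 10 - 4 * q ^ 4 * hn 8
      + 6 * q ^ 8 * hn 4 - 6 * q ^ 10 * hn 2
  -- A Bézout identity over `ℤ[q²]` for `D` and its reciprocal, with the nonzero integer `235` as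
  -- the combination.
  have h235 : (235 : ℂ) = 0 := by
    linear_combination (-714 + 1120 * q ^ 2 - 596 * q ^ 4 - 1224 * q ^ 6 + 1648 * q ^ 8
      - 612 * q ^ 10) * h + (-1193 + 1752 * q ^ 2 - 416 * q ^ 4 - 824 * q ^ 6 + 1130 * q ^ 8
      - 306 * q ^ 10) * hr
  norm_num at h235

end Denominator

section Family

open OrdPoly

variable {q s : ℂ} {I : Type*} [LinearOrder I]

theorem IsPascalFamily.eq_coeffEval (hq0 : q ≠ 0) (hD : pascalDenom q ≠ 0) {α β : ℂ}
    {a : Fin 12 → ℂ} (h : IsPascalFamily q α β a) (i : Fin 12) :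
    a i = α / (q ^ 6 * pascalDenom q) * coeffEval q (pascalAlpha i) +
      β * coeffEval q (pascalBeta i) := by
  obtain ⟨h0, h8, h1, h7, h2, h6, h3, h9, h4, h11, h5, h10⟩ := h
  rw [h2] at h6
  rw [h3] at h9
  rw [h4] at h11
  rw [h5] at h10
  fin_cases i <;>
    simp only [pascalAlpha, pascalBeta, Fin.mk_zero, Fin.mk_one, Fin.reduceFinMk,
      Matrix.cons_val, Matrix.cons_val_zero, Matrix.cons_val_one, coeffEval, h0, h1, h2, h3, h4,
      h5, h6, h7, h8, h9, h10, h11] <;>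
    field_simp <;> push_cast <;> (try rw [pascalDenom]) <;> ring

theorem pascalCombination_eq_zero_of_isPascalFamily (hs : s ^ 2 = q) (hq : ‖q‖ = 1)
    (hq4 : q ^ 2 ≠ -1) {p : Fin 7 → I} (hp : StrictMono p) {α β : ℂ} {a : Fin 12 → ℂ}
    (h : IsPascalFamily q α β a) : pascalCombination q s p a = 0 := by
  have hs0 := root_ne_zero hs hq
  have hq0 : q ≠ 0 := hs ▸ pow_ne_zero 2 hs0
  have hz := isZero_pascalLinComb
  rw [Bool.and_eq_true] at hz
  have hβ := eval_pascalLinComb hq0 hq4 hp pascalBeta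
  have hα := eval_pascalLinComb hq0 hq4 hp pascalAlpha
  rw [eval_eq_zero q hz.1] at hβ
  rw [eval_eq_zero q hz.2] at hα
  have hc : jacobianScale q ^ 3 * s ^ 13 ≠ 0 :=
    mul_ne_zero (pow_ne_zero 3 (jacobianScale_ne_zero hq0 hq4)) (pow_ne_zero 13 hs0)
  refine (smul_eq_zero_iff_right hc).1 ?_
  rw [smul_pascalCombination hs hs0 hq4 hp]
  simp only [h.eq_coeffEval hq0 (pascalDenom_ne_zero hq), add_smul, mul_smul,
    Finset.sum_add_distrib, ← Finset.smul_sum, ← hα, ← hβ, smul_zero, add_zero]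

end Family

/-! ### Certificates for the linear relations between the coefficients. -/

/-- The substitution of `q ^ 2` for `q` in a coefficient list, followed by the multiplication by
`q ^ n`. -/
noncomputable def coeffSpread (n : ℕ) (a : List ℤ) : List ℤ :=
  Nat.rec (motive := fun _ => List ℤ)
    (List.rec (motive := fun _ => List ℤ) [] (fun x _ ih => x :: 0 :: ih) a)
    (fun _ ih => 0 :: ih) n

/-- Powers of coefficient lists. -/
noncomputable def coeffPow (a : List ℤ) (n : ℕ) : List ℤ :=
  Nat.rec (motive := fun _ => List ℤ) [1] (fun _ ih => coeffMul a ih) n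

theorem coeffEval_spread (q : ℂ) (n : ℕ) (a : List ℤ) :
    coeffEval q (coeffSpread n a) = q ^ n * coeffEval (q ^ 2) a := by
  induction n with
  | zero =>
    induction a with
    | nil => exact (mul_zero _).symm
    | cons x as ih =>
      change x + q * (((0 : ℤ) : ℂ) + q * coeffEval q (coeffSpread 0 as)) = _
      rw [ih, coeffEval]
      push_cast
      ring
  | succ n ih =>
    change ((0 : ℤ) : ℂ) + q * coeffEval q (coeffSpread n a) = _
    rw [ih]
    push_cast
    ring

theorem coeffEval_pow (q : ℂ) (a : List ℤ) (n : ℕ) :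
    coeffEval q (coeffPow a n) = coeffEval q a ^ n := by
  induction n with
  | zero =>
    change ((1 : ℤ) : ℂ) + q * 0 = _
    simp
  | succ n ih =>
    change coeffEval q (coeffMul a (coeffPow a n)) = _
    rw [coeffEval_mul, ih, pow_succ']

/-- A certificate that the vanishing of `pascalCombination` implies the linear relation between
the entries of `a` with the coefficients `target`, polynomials in `q ^ 2`: the linear combination
of the coefficients of the monomials `m` with the coefficients `q ^ n * c (q ^ 2)`, for `(m, n, c)`
in `cert`, is this relation multiplied by `scale` and by powers of `q`, `q ^ 2 + 1`, `q ^ 2 - 1`,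
`q ^ 4 + 1` and `q ^ 4 - q ^ 2 + 1` with the exponents `exps`. -/
structure PascalRelation where
  cert : List (List ℕ × ℕ × List ℤ)
  scale : ℤ
  exps : ℕ × ℕ × ℕ × ℕ × ℕ
  target : Fin 12 → List ℤ

namespace PascalRelation

open OrdPoly

/-- The factor of the relation in the linear combination of the coefficients. -/
noncomputable def factor (R : PascalRelation) : List ℤ :=
  coeffScale R.scale (coeffMul (coeffPow [0, 1] R.exps.1) (coeffMul (coeffPow [1, 0, 1] R.exps.2.1)
    (coeffMul (coeffPow [-1, 0, 1] R.exps.2.2.1) (coeffMul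
      (coeffPow [1, 0, 0, 0, 1] R.exps.2.2.2.1) (coeffPow [1, 0, -1, 0, 1] R.exps.2.2.2.2)))))

/-- A linear combination of the coefficients of a polynomial. -/
noncomputable def combine (cert : List (List ℕ × ℕ × List ℤ)) (t : OrdPoly) : List ℤ :=
  List.rec (motive := fun _ => List ℤ) []
    (fun x _ ih => coeffAdd (coeffMul (coeffSpread x.2.1 x.2.2) (coeff x.1 t)) ih) cert

/-- The difference of the two sides in the definition of a certificate. -/
noncomputable def defect (R : PascalRelation) (i : Fin 12) : List ℤ :=
  coeffAdd (combine R.cert (pascalTerm i))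
    (coeffScale (-1) (coeffMul R.factor (coeffSpread 0 (R.target i))))

/-- The condition on a certificate. -/
noncomputable def isValid (R : PascalRelation) : Bool :=
  R.cert.all (fun x => x.1.length.beq 12) &&
    [0, 1, 2, 3, 4, 5, 6, 7, 8, 9, 10, 11].all (fun i => coeffIsZero (R.defect i))

variable {q s : ℂ} {I : Type*} [LinearOrder I]

/-- This is where independence of the ordered monomials enters: the coefficient functional turns one
equation in `H_I` into a scalar equation for each monomial. -/
theorem sum_coeff_eq_zero (hs : s ^ 2 = q) (hs0 : s ≠ 0) (hq4 : q ^ 2 ≠ -1)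
    {p : Fin 7 → I} (hp : StrictMono p) {a : Fin 12 → ℂ} (h : pascalCombination q s p a = 0)
    {m : List ℕ} (hm : m.length = 12) :
    ∑ i, a i * coeffEval q (coeff m (pascalTerm i)) = 0 := by
  obtain ⟨l, hl⟩ := exists_coeff_functional (q := q) (hexagon_pairwise hp) (m := m) (by simpa [hexagon])
  have h' := congrArg l (smul_pascalCombination hs hs0 hq4 hp a)
  rw [h, smul_zero, map_zero, map_sum] at h'
  simpa only [map_smul, hl, smul_eq_mul] using h'.symm

theorem sum_combine_eq_zero (hs : s ^ 2 = q) (hs0 : s ≠ 0) (hq4 : q ^ 2 ≠ -1)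
    {p : Fin 7 → I} (hp : StrictMono p) {a : Fin 12 → ℂ} (h : pascalCombination q s p a = 0)
    {cert : List (List ℕ × ℕ × List ℤ)} (hc : ∀ x ∈ cert, x.1.length = 12) :
    ∑ i, a i * coeffEval q (combine cert (pascalTerm i)) = 0 := by
  induction cert with
  | nil => exact Finset.sum_eq_zero fun i _ => mul_zero _
  | cons x cert ih =>
    have e : ∀ i, a i * coeffEval q (combine (x :: cert) (pascalTerm i)) =
        coeffEval q (coeffSpread x.2.1 x.2.2) * (a i * coeffEval q (coeff x.1 (pascalTerm i))) +
          a i * coeffEval q (combine cert (pascalTerm i)) := by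
      intro i
      change a i * coeffEval q (coeffAdd (coeffMul _ _) (combine cert (pascalTerm i))) = _
      rw [coeffEval_add, coeffEval_mul]
      ring
    rw [List.forall_mem_cons] at hc
    simp only [e, Finset.sum_add_distrib, ← Finset.mul_sum, ih hc.2,
      sum_coeff_eq_zero hs hs0 hq4 hp h hc.1, mul_zero, add_zero]

/-- The certificate proves the relation times `R.factor`. The excluded roots of unity are the zeros
of the cyclotomic factors of `R.factor`, so the factor can be cancelled. -/
theorem sum_target_eq_zero {R : PascalRelation} (hR : R.isValid = true) (hn : R.scale ≠ 0)
    (hs : s ^ 2 = q) (hs0 : s ≠ 0) (hq4 : q ^ 2 ≠ -1) (hq1 : q ^ 2 ≠ 1) (hq8 : q ^ 4 ≠ -1)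
    (hq12 : q ^ 4 - q ^ 2 + 1 ≠ 0) {p : Fin 7 → I} (hp : StrictMono p) {a : Fin 12 → ℂ}
    (h : pascalCombination q s p a = 0) :
    ∑ i, a i * coeffEval (q ^ 2) (R.target i) = 0 := by
  have hq0 : q ≠ 0 := hs ▸ pow_ne_zero 2 hs0
  have hf : coeffEval q R.factor ≠ 0 := by
    simp only [factor, coeffEval_scale, coeffEval_mul, coeffEval_pow, coeffEval]
    refine mul_ne_zero (Int.cast_ne_zero.2 hn) (mul_ne_zero (pow_ne_zero _ ?_) (mul_ne_zero
      (pow_ne_zero _ ?_) (mul_ne_zero (pow_ne_zero _ ?_) (mul_ne_zero (pow_ne_zero _ ?_)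
      (pow_ne_zero _ ?_))))) <;> push_cast
    · simpa using hq0
    · exact fun h => hq4 (by linear_combination h)
    · exact fun h => hq1 (by linear_combination h)
    · exact fun h => hq8 (by linear_combination h)
    · exact fun h => hq12 (by linear_combination h)
  simp only [isValid, Bool.and_eq_true, List.all_eq_true] at hR
  have hz : ∀ i, coeffEval q (R.defect i) = 0 := fun i =>
    coeffEval_eq_zero q (hR.2 i (by fin_cases i <;> decide))
  have hc := sum_combine_eq_zero hs hs0 hq4 hp h
    (fun x hx => Nat.eq_of_beq_eq_true (hR.1 x hx))
  have e : ∀ i, coeffEval q (combine R.cert (pascalTerm i)) =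
      coeffEval q R.factor * coeffEval (q ^ 2) (R.target i) := by
    intro i
    have := hz i
    rw [defect, coeffEval_add, coeffEval_scale, coeffEval_mul, coeffEval_spread] at this
    push_cast at this
    linear_combination this
  simp only [e] at hc
  refine (mul_eq_zero_iff_left hf).1 ?_
  rw [← hc, Finset.mul_sum]
  exact Finset.sum_congr rfl fun i _ => by ring

/-- The certificate of the relation between the entries zero, eight. -/
def pascalRelation_zero_eight : PascalRelation where
  -- The exponents belong to `y₁, x₁, …, y₆, x₆` in this order. Each vertex has total degree two,
  -- since it lies in two of the six forms of a combinant.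
  cert := [([2, 0, 0, 2, 0, 2, 2, 0, 2, 0, 0, 2], 5, [-8, -2, 18, -38, 1, 2, 11, 5]),
    ([2, 0, 0, 2, 1, 1, 1, 1, 2, 0, 0, 2], 4, [-2, 16, -10, -7, 11, 0, -14, 12]),
    ([2, 0, 0, 2, 1, 1, 2, 0, 1, 1, 0, 2], 4, [4, -7, 4, 6, -6, -4, 16, -6]),
    ([2, 0, 1, 1, 0, 2, 1, 1, 2, 0, 0, 2], 4, [4, -7, 4, 6, -6, -4, 16, -6]),
    ([2, 0, 0, 2, 2, 0, 0, 2, 2, 0, 0, 2], 3, [0, 11, -8, 6, 6, -11, -12, -7]),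
    ([2, 0, 0, 2, 2, 0, 1, 1, 1, 1, 0, 2], 2, [-3, -4, 7, -11, -7, 12, -6, -2]),
    ([2, 0, 1, 1, 1, 1, 0, 2, 2, 0, 0, 2], 2, [-3, -4, 7, -11, -7, 12, -6, -2]),
    ([2, 0, 0, 2, 2, 0, 2, 0, 0, 2, 0, 2], 1, [-3, -3, -1, 4, 9, 6, 0, -12]),
    ([2, 0, 2, 0, 0, 2, 0, 2, 2, 0, 0, 2], 1, [-3, -3, -1, 4, 9, 6, 0, -12]),
    ([2, 0, 1, 1, 0, 2, 2, 0, 1, 1, 0, 2], 4, [-9, 15, -1, -6, 8, 21, -16]),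
    ([2, 0, 1, 1, 1, 1, 1, 1, 1, 1, 0, 2], 3, [22, 2, 2, 10, -12, -1, 4]),
    ([2, 0, 1, 1, 1, 1, 2, 0, 0, 2, 0, 2], 2, [12, 7, 1, -15, 3, -6, 1, -4]),
    ([2, 0, 2, 0, 0, 2, 1, 1, 1, 1, 0, 2], 2, [12, 7, 1, -15, 3, -6, 1, -4]),
    ([2, 0, 1, 1, 2, 0, 0, 2, 1, 1, 0, 2], 2, [10, -24, -18, 1, 20, 2, 5, -4]),
    ([2, 0, 1, 1, 2, 0, 1, 1, 0, 2, 0, 2], 0, [5, -12, 17, 2, 27, -17, 2]),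
    ([2, 0, 2, 0, 1, 1, 0, 2, 1, 1, 0, 2], 0, [5, -12, 17, 2, 27, -17, 2]),
    ([2, 0, 2, 0, 0, 2, 2, 0, 0, 2, 0, 2], 3, [8, -37, 4, 3, -15, -8, -1, -9]),
    ([2, 0, 2, 0, 1, 1, 1, 1, 0, 2, 0, 2], 2, [27, 21, -31, 8, -28, 13]),
    ([2, 0, 2, 0, 2, 0, 0, 2, 0, 2, 0, 2], 1, [14, -23, -1, -13, 26, 25, -13])]
  scale := 24
  exps := (37, 6, 3, 1, 0)
  target := ![[1], [], [], [], [], [], [], [], [-1], [], [], []]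

/-- The certificate of the relation between the entries one, seven. -/
def pascalRelation_one_seven : PascalRelation where
  cert := [([2, 0, 0, 2, 0, 2, 2, 0, 2, 0, 0, 2], 5, [0, -6, 11, 6, -21, 0, 5, -4]),
    ([2, 0, 0, 2, 1, 1, 1, 1, 2, 0, 0, 2], 4, [-8, -9, 9, 1, -2, -10, -6]),
    ([2, 0, 0, 2, 1, 1, 2, 0, 1, 1, 0, 2], 4, [5, 2, -10, -6, -6, -2, -2, 3]),
    ([2, 0, 1, 1, 0, 2, 1, 1, 2, 0, 0, 2], 4, [5, 2, -10, -6, -6, -2, -2, 3]),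
    ([2, 0, 0, 2, 2, 0, 0, 2, 2, 0, 0, 2], 3, [0, -5, 22, 11, -20, 2, 21, 9]),
    ([2, 0, 0, 2, 2, 0, 1, 1, 1, 1, 0, 2], 2, [-7, -9, -2, 5, 11, 4, 0, 5]),
    ([2, 0, 1, 1, 1, 1, 0, 2, 2, 0, 0, 2], 2, [-7, -9, -2, 5, 11, 4, 0, 5]),
    ([2, 0, 0, 2, 2, 0, 2, 0, 0, 2, 0, 2], 1, [-7, -10, 6, 25, 11, -4, -3, -5]),
    ([2, 0, 2, 0, 0, 2, 0, 2, 2, 0, 0, 2], 1, [-7, -10, 6, 25, 11, -4, -3, -5]),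
    ([2, 0, 1, 1, 0, 2, 2, 0, 1, 1, 0, 2], 4, [-6, 2, 8, -4, -4, -4, 7]),
    ([2, 0, 1, 1, 1, 1, 1, 1, 1, 1, 0, 2], 3, [4, 1, 9, 2, -5, 6, -1]),
    ([2, 0, 1, 1, 1, 1, 2, 0, 0, 2, 0, 2], 2, [6, 8, 2, -9, -10, -1, 3, 1]),
    ([2, 0, 2, 0, 0, 2, 1, 1, 1, 1, 0, 2], 2, [6, 8, 2, -9, -10, -1, 3, 1]),
    ([2, 0, 1, 1, 2, 0, 0, 2, 1, 1, 0, 2], 2, [-12, 4, -1, -17, -11, 10, 2, 1]),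
    ([2, 0, 1, 1, 2, 0, 1, 1, 0, 2, 0, 2], 0, [-6, 8, -14, 7, 11, 4, 4]),
    ([2, 0, 2, 0, 1, 1, 0, 2, 1, 1, 0, 2], 0, [-6, 8, -14, 7, 11, 4, 4]),
    ([2, 0, 2, 0, 0, 2, 2, 0, 0, 2, 0, 2], 3, [-10, -4, -2, 21, 5, -5, 14, 7]),
    ([2, 0, 2, 0, 1, 1, 1, 1, 0, 2, 0, 2], 2, [4, 13, 3, 0, 0, 4]),
    ([2, 0, 2, 0, 2, 0, 0, 2, 0, 2, 0, 2], 1, [-8, -3, -13, 3, -20, -22, 12, -3])]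
  scale := 24
  exps := (49, 6, 3, 0, 0)
  target := ![[], [1], [], [], [], [], [], [-1], [], [], [], []]

/-- The certificate of the relation between the entries two, six. -/
def pascalRelation_two_six : PascalRelation where
  cert := [([2, 0, 0, 2, 0, 2, 2, 0, 2, 0, 0, 2], 5, [-10, -28, 31, -4, 28, -25, 28]),
    ([2, 0, 0, 2, 1, 1, 1, 1, 2, 0, 0, 2], 4, [-2, 33, -10, -26, 22, -11, -16, 28]),
    ([2, 0, 0, 2, 1, 1, 2, 0, 1, 1, 0, 2], 4, [13, 9, 4, 23, -7, -6, 28, -12]),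
    ([2, 0, 1, 1, 0, 2, 1, 1, 2, 0, 0, 2], 4, [13, 9, 4, 23, -7, -6, 28, -12]),
    ([2, 0, 0, 2, 2, 0, 0, 2, 2, 0, 0, 2], 3, [0, 18, -22, 16, 6, -7, 4, 14]),
    ([2, 0, 0, 2, 2, 0, 1, 1, 1, 1, 0, 2], 2, [0, -4, -1, -41, -9, 3, -9, -2]),
    ([2, 0, 1, 1, 1, 1, 0, 2, 2, 0, 0, 2], 2, [0, -4, -1, -41, -9, 3, -9, -2]),
    ([2, 0, 0, 2, 2, 0, 2, 0, 0, 2, 0, 2], 1, [0, -6, 2, -7, -7, 18, 19, -11]),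
    ([2, 0, 2, 0, 0, 2, 0, 2, 2, 0, 0, 2], 1, [0, -6, 2, -7, -7, 18, 19, -11]),
    ([2, 0, 1, 1, 0, 2, 2, 0, 1, 1, 0, 2], 4, [11, 9, 7, 0, 2, 33, -34]),
    ([2, 0, 1, 1, 1, 1, 1, 1, 1, 1, 0, 2], 3, [16, -24, 16, 12, -20, -1, 10]),
    ([2, 0, 1, 1, 1, 1, 2, 0, 0, 2, 0, 2], 2, [9, 14, 9, 3, 10, -18, 7, -10]),
    ([2, 0, 2, 0, 0, 2, 1, 1, 1, 1, 0, 2], 2, [9, 14, 9, 3, 10, -18, 7, -10]),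
    ([2, 0, 1, 1, 2, 0, 0, 2, 1, 1, 0, 2], 2, [-8, 2, -4, 7, -5, -2, 17, -10]),
    ([2, 0, 1, 1, 2, 0, 1, 1, 0, 2, 0, 2], 0, [-4, 13, 0, -21, 23, -32, 8]),
    ([2, 0, 2, 0, 1, 1, 0, 2, 1, 1, 0, 2], 0, [-4, 13, 0, -21, 23, -32, 8]),
    ([2, 0, 2, 0, 0, 2, 2, 0, 0, 2, 0, 2], 3, [19, -29, -22, -13, -26, -2, -24, -10]),
    ([2, 0, 2, 0, 1, 1, 1, 1, 0, 2, 0, 2], 2, [14, -23, 1, 21, -49, 13, 2]),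
    ([2, 0, 2, 0, 2, 0, 0, 2, 0, 2, 0, 2], 1, [2, 45, -21, 10, 0, 10, 25, -10])]
  scale := 24
  exps := (35, 6, 3, 1, 0)
  target := ![[], [], [1], [], [], [], [-1], [], [], [], [], []]

/-- The certificate of the relation between the entries three, nine. -/
def pascalRelation_three_nine : PascalRelation where
  cert := [([2, 0, 0, 2, 0, 2, 2, 0, 2, 0, 0, 2], 5, [10, 15, -10, -22, 0, 6, 6, 10]),
    ([2, 0, 0, 2, 1, 1, 1, 1, 2, 0, 0, 2], 4, [4, 3, -22, -2, 16, 0, -5, 12]),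
    ([2, 0, 0, 2, 1, 1, 2, 0, 1, 1, 0, 2], 4, [-5, -19, 11, 8, -7, -1, 16, -4]),
    ([2, 0, 1, 1, 0, 2, 1, 1, 2, 0, 0, 2], 4, [-5, -19, 11, 8, -7, -1, 16, -4]),
    ([2, 0, 0, 2, 2, 0, 0, 2, 2, 0, 0, 2], 3, [0, 5, -6, -11, 11, -7, -20, -19]),
    ([2, 0, 0, 2, 2, 0, 1, 1, 1, 1, 0, 2], 2, [1, 7, 7, -2, -1, 1, -8, 1]),
    ([2, 0, 1, 1, 1, 1, 0, 2, 2, 0, 0, 2], 2, [1, 7, 7, -2, -1, 1, -8, 1]),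
    ([2, 0, 0, 2, 2, 0, 2, 0, 0, 2, 0, 2], 1, [1, 10, 11, -10, -3, -1, 3, -1]),
    ([2, 0, 2, 0, 0, 2, 0, 2, 2, 0, 0, 2], 1, [1, 10, 11, -10, -3, -1, 3, -1]),
    ([2, 0, 1, 1, 0, 2, 2, 0, 1, 1, 0, 2], 4, [-16, 15, -3, -7, 13, 18, -12]),
    ([2, 0, 1, 1, 1, 1, 1, 1, 1, 1, 0, 2], 3, [10, 0, 0, -4, -9, 6, 4]),
    ([2, 0, 1, 1, 1, 1, 2, 0, 0, 2, 0, 2], 2, [3, -9, -6, -10, 6, 1, 0, -4]),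
    ([2, 0, 2, 0, 0, 2, 1, 1, 1, 1, 0, 2], 2, [3, -9, -6, -10, 6, 1, 0, -4]),
    ([2, 0, 1, 1, 2, 0, 0, 2, 1, 1, 0, 2], 2, [18, -18, -14, 11, 22, 7, 4, -4]),
    ([2, 0, 1, 1, 2, 0, 1, 1, 0, 2, 0, 2], 0, [9, -11, 16, 11, 14, -12, 5]),
    ([2, 0, 2, 0, 1, 1, 0, 2, 1, 1, 0, 2], 0, [9, -11, 16, 11, 14, -12, 5]),
    ([2, 0, 2, 0, 0, 2, 2, 0, 0, 2, 0, 2], 3, [-9, -9, 14, -11, -20, 2, -12, -14]),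
    ([2, 0, 2, 0, 1, 1, 1, 1, 0, 2, 0, 2], 2, [27, -7, -16, -12, -9, 8, 1]),
    ([2, 0, 2, 0, 2, 0, 0, 2, 0, 2, 0, 2], 1, [8, -15, -3, 7, 36, 40, -18])]
  scale := 24
  exps := (35, 6, 3, 0, 0)
  target := ![[], [], [], [1], [], [], [], [], [], [-1], [], []]

/-- The certificate of the relation between the entries four, eleven. -/
def pascalRelation_four_eleven : PascalRelation where
  cert := [([2, 0, 0, 2, 0, 2, 2, 0, 2, 0, 0, 2], 5, [-9, 31, 7, 8, -22, 5, -26, -6]),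
    ([2, 0, 0, 2, 1, 1, 1, 1, 2, 0, 0, 2], 4, [4, -8, 18, -2, -6, 19, 14, -16]),
    ([2, 0, 0, 2, 1, 1, 2, 0, 1, 1, 0, 2], 4, [-5, 19, -9, -7, 9, -2, -17, 8]),
    ([2, 0, 1, 1, 0, 2, 1, 1, 2, 0, 0, 2], 4, [-5, 19, -9, -7, 9, -2, -17, 8]),
    ([2, 0, 0, 2, 2, 0, 0, 2, 2, 0, 0, 2], 3, [0, 7, 0, -12, 7, -6, -7, -8]),
    ([2, 0, 0, 2, 2, 0, 1, 1, 1, 1, 0, 2], 2, [4, 4, 7, 15, 3, 3, 10, 2]),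
    ([2, 0, 1, 1, 1, 1, 0, 2, 2, 0, 0, 2], 2, [4, 4, 7, 15, 3, 3, 10, 2]),
    ([2, 0, 0, 2, 2, 0, 2, 0, 0, 2, 0, 2], 1, [4, 16, 0, -21, 28, -1, -11, 13]),
    ([2, 0, 2, 0, 0, 2, 0, 2, 2, 0, 0, 2], 1, [4, 16, 0, -21, 28, -1, -11, 13]),
    ([2, 0, 1, 1, 0, 2, 2, 0, 1, 1, 0, 2], 4, [22, -20, 3, -1, -7, -22, 20]),
    ([2, 0, 1, 1, 1, 1, 1, 1, 1, 1, 0, 2], 3, [-2, 14, -9, -1, 13, 4, -4]),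
    ([2, 0, 1, 1, 1, 1, 2, 0, 0, 2, 0, 2], 2, [-3, -2, 12, -2, -10, 16, -4, 4]),
    ([2, 0, 2, 0, 0, 2, 1, 1, 1, 1, 0, 2], 2, [-3, -2, 12, -2, -10, 16, -4, 4]),
    ([2, 0, 1, 1, 2, 0, 0, 2, 1, 1, 0, 2], 2, [12, 14, -14, -3, -8, 7, -8, 4]),
    ([2, 0, 1, 1, 2, 0, 1, 1, 0, 2, 0, 2], 0, [6, -4, 4, -3, -10, 30, -2]),
    ([2, 0, 2, 0, 1, 1, 0, 2, 1, 1, 0, 2], 0, [6, -4, 4, -3, -10, 30, -2]),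
    ([2, 0, 2, 0, 0, 2, 2, 0, 0, 2, 0, 2], 3, [35, -13, 0, -3, 38, -4, -2, 6]),
    ([2, 0, 2, 0, 1, 1, 1, 1, 0, 2, 0, 2], 2, [-13, 17, 17, -14, 30, -11, 2]),
    ([2, 0, 2, 0, 2, 0, 0, 2, 0, 2, 0, 2], 1, [6, -7, 3, -27, 1, 18, -19, -4])]
  scale := -24
  exps := (43, 6, 3, 1, 0)
  target := ![[], [], [], [], [1], [], [], [], [], [], [], [-1]]

/-- The certificate of the relation between the entries five, ten. -/
def pascalRelation_five_ten : PascalRelation where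
  cert := [([2, 0, 0, 2, 0, 2, 2, 0, 2, 0, 0, 2], 5, [3, 1, -1, 8, -5, 11, -22, -2]),
    ([2, 0, 0, 2, 1, 1, 1, 1, 2, 0, 0, 2], 4, [-12, -11, 14, -2, -1, 16, 9, -20]),
    ([2, 0, 0, 2, 1, 1, 2, 0, 1, 1, 0, 2], 4, [-1, 9, 2, -6, 13, 2, -17, 4]),
    ([2, 0, 1, 1, 0, 2, 1, 1, 2, 0, 0, 2], 4, [-1, 9, 2, -6, 13, 2, -17, 4]),
    ([2, 0, 0, 2, 2, 0, 0, 2, 2, 0, 0, 2], 3, [0, 0, 8, 3, -1, -25, -6, 3]),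
    ([2, 0, 0, 2, 2, 0, 1, 1, 1, 1, 0, 2], 2, [-13, -12, -2, -6, -4, 8, 6, -8]),
    ([2, 0, 1, 1, 1, 1, 0, 2, 2, 0, 0, 2], 2, [-13, -12, -2, -6, -4, 8, 6, -8]),
    ([2, 0, 0, 2, 2, 0, 2, 0, 0, 2, 0, 2], 1, [-13, -23, 5, 2, 29, -4, -17, 14]),
    ([2, 0, 2, 0, 0, 2, 0, 2, 2, 0, 0, 2], 1, [-13, -23, 5, 2, 29, -4, -17, 14]),
    ([2, 0, 1, 1, 0, 2, 2, 0, 1, 1, 0, 2], 4, [14, 8, -4, 4, -2, -17, 10]),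
    ([2, 0, 1, 1, 1, 1, 1, 1, 1, 1, 0, 2], 3, [-2, -1, -5, 12, 15, -9, -2]),
    ([2, 0, 1, 1, 1, 1, 2, 0, 0, 2, 0, 2], 2, [5, -2, 10, -5, -3, 10, -9, 2]),
    ([2, 0, 2, 0, 0, 2, 1, 1, 1, 1, 0, 2], 2, [5, -2, 10, -5, -3, 10, -9, 2]),
    ([2, 0, 1, 1, 2, 0, 0, 2, 1, 1, 0, 2], 2, [-14, 6, 1, 5, -15, -16, -11, 2]),
    ([2, 0, 1, 1, 2, 0, 1, 1, 0, 2, 0, 2], 0, [-7, -5, 5, -4, -13, 23, -10]),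
    ([2, 0, 2, 0, 1, 1, 0, 2, 1, 1, 0, 2], 0, [-7, -5, 5, -4, -13, 23, -10]),
    ([2, 0, 2, 0, 0, 2, 2, 0, 0, 2, 0, 2], 3, [-9, -5, -7, -3, 15, -11, -5, 11]),
    ([2, 0, 2, 0, 1, 1, 1, 1, 0, 2, 0, 2], 2, [-9, -3, 1, 3, 25, -19, 4]),
    ([2, 0, 2, 0, 2, 0, 0, 2, 0, 2, 0, 2], 1, [-4, 1, 21, -9, 2, -23, -23, 1])]
  scale := 24
  exps := (47, 6, 3, 1, 0)
  target := ![[], [], [], [], [], [1], [], [], [], [], [-1], []]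

/-- The certificate of the relation between the entries two, zero. -/
def pascalRelation_two_zero : PascalRelation where
  cert := [([2, 0, 0, 2, 1, 1, 2, 0, 1, 1, 0, 2], 4, [2, -3, 1, 1]),
    ([2, 0, 1, 1, 0, 2, 1, 1, 2, 0, 0, 2], 4, [-2, 3, -1, -1]),
    ([2, 0, 0, 2, 2, 0, 1, 1, 1, 1, 0, 2], 2, [0, -3, 2]),
    ([2, 0, 1, 1, 1, 1, 0, 2, 2, 0, 0, 2], 2, [0, 3, -2]),
    ([2, 0, 0, 2, 2, 0, 2, 0, 0, 2, 0, 2], 1, [0, -3, 6, -3, 1, 1]),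
    ([2, 0, 2, 0, 0, 2, 0, 2, 2, 0, 0, 2], 1, [0, 3, -6, 3, -1, -1]),
    ([2, 0, 1, 1, 1, 1, 2, 0, 0, 2, 0, 2], 2, [2, -3, 2]),
    ([2, 0, 2, 0, 0, 2, 1, 1, 1, 1, 0, 2], 2, [-2, 3, -2]),
    ([2, 0, 1, 1, 2, 0, 1, 1, 0, 2, 0, 2], 0, [0, -1, 1]),
    ([2, 0, 2, 0, 1, 1, 0, 2, 1, 1, 0, 2], 0, [0, 1, -1])]
  scale := 1
  exps := (35, 7, 2, 0, 1)
  target := ![[0, -2, 2, 2, -5, 2], [], [-2, 6, -6, 0, 4, -4, 1], [], [], [],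
    [-2, 6, -6, 0, 4, -4, 1], [], [0, -2, 2, 2, -5, 2], [], [], []]

/-- The certificate of the relation between the entries three, zero, one. -/
def pascalRelation_three_zero_one : PascalRelation where
  cert := [([2, 0, 0, 2, 1, 1, 2, 0, 1, 1, 0, 2], 4, [-2, 4, 0, -5, 3, 2, -3]),
    ([2, 0, 1, 1, 0, 2, 1, 1, 2, 0, 0, 2], 4, [2, -4, 0, 5, -3, -2, 3]),
    ([2, 0, 0, 2, 2, 0, 1, 1, 1, 1, 0, 2], 2, [0, 2, -2, -1, 3, 0, -2, 1]),
    ([2, 0, 1, 1, 1, 1, 0, 2, 2, 0, 0, 2], 2, [0, -2, 2, 1, -3, 0, 2, -1]),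
    ([2, 0, 0, 2, 2, 0, 2, 0, 0, 2, 0, 2], 1, [0, 2, -4, 1, 6, -5, -2, 6, -3, -1]),
    ([2, 0, 2, 0, 0, 2, 0, 2, 2, 0, 0, 2], 1, [0, -2, 4, -1, -6, 5, 2, -6, 3, 1]),
    ([2, 0, 1, 1, 1, 1, 2, 0, 0, 2, 0, 2], 2, [-2, 4, 1, -7, 4, 3, -5, 1]),
    ([2, 0, 2, 0, 0, 2, 1, 1, 1, 1, 0, 2], 2, [2, -4, -1, 7, -4, -3, 5, -1]),
    ([2, 0, 1, 1, 2, 0, 1, 1, 0, 2, 0, 2], 0, [0, 2, -3, 1, 2, -1]),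
    ([2, 0, 2, 0, 1, 1, 0, 2, 1, 1, 0, 2], 0, [0, -2, 3, -1, -2, 1])]
  scale := 1
  exps := (39, 6, 1, 1, 0)
  target := ![[0, -2, 6, -4, -6, 12, -6, -4, 6, -2],
    [0, 0, 0, 0, 0, 0, 0, 2, -6, 6, 0, -4, 4, -1], [], [-2, 6, -6, 0, 4, -4, 1], [], [], [],
    [0, 0, 0, 0, 0, 0, 0, 2, -6, 6, 0, -4, 4, -1], [0, -2, 6, -4, -6, 12, -6, -4, 6, -2],
    [-2, 6, -6, 0, 4, -4, 1], [], []]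

/-- The certificate of the relation between the entries four, zero. -/
def pascalRelation_four_zero : PascalRelation where
  cert := [([2, 0, 0, 2, 1, 1, 2, 0, 1, 1, 0, 2], 4, [2, -4, 0, 6, -5, 0, 2, 0, -1]),
    ([2, 0, 1, 1, 0, 2, 1, 1, 2, 0, 0, 2], 4, [-2, 4, 0, -6, 5, 0, -2, 0, 1]),
    ([2, 0, 0, 2, 2, 0, 1, 1, 1, 1, 0, 2], 2, [0, -4, 5, 3, -8, 4, 1, -2, -1]),
    ([2, 0, 1, 1, 1, 1, 0, 2, 2, 0, 0, 2], 2, [0, 4, -5, -3, 8, -4, -1, 2, 1]),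
    ([2, 0, 0, 2, 2, 0, 2, 0, 0, 2, 0, 2], 1, [0, -4, 10, -3, -13, 17, -5, -5, 4]),
    ([2, 0, 2, 0, 0, 2, 0, 2, 2, 0, 0, 2], 1, [0, 4, -10, 3, 13, -17, 5, 5, -4]),
    ([2, 0, 1, 1, 1, 1, 2, 0, 0, 2, 0, 2], 2, [3, -6, 0, 10, -9, 1, 4, -2]),
    ([2, 0, 2, 0, 0, 2, 1, 1, 1, 1, 0, 2], 2, [-3, 6, 0, -10, 9, -1, -4, 2]),
    ([2, 0, 1, 1, 2, 0, 1, 1, 0, 2, 0, 2], 0, [1, -6, 9, -2, -6, 6, -2, -1]),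
    ([2, 0, 2, 0, 1, 1, 0, 2, 1, 1, 0, 2], 0, [-1, 6, -9, 2, 6, -6, 2, 1])]
  scale := 1
  exps := (41, 7, 2, 1, 1)
  target := ![[-2, 5, -2, -2, 2], [], [], [], [0, 0, -2, 6, -6, 0, 4, -4, 1], [], [], [],
    [-2, 5, -2, -2, 2], [], [], [0, 0, -2, 6, -6, 0, 4, -4, 1]]

/-- The certificate of the relation between the entries five, zero. -/
def pascalRelation_five_zero : PascalRelation where
  cert := [([2, 0, 0, 2, 1, 1, 2, 0, 1, 1, 0, 2], 4, [-1, 4, -1, -3, 2, 3, -3, -1, 1]),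
    ([2, 0, 1, 1, 0, 2, 1, 1, 2, 0, 0, 2], 4, [1, -4, 1, 3, -2, -3, 3, 1, -1]),
    ([2, 0, 0, 2, 2, 0, 1, 1, 1, 1, 0, 2], 2, [1, 3, -5, -1, 4, -1, -4, 1, 1]),
    ([2, 0, 1, 1, 1, 1, 0, 2, 2, 0, 0, 2], 2, [-1, -3, 5, 1, -4, 1, 4, -1, -1]),
    ([2, 0, 0, 2, 2, 0, 2, 0, 0, 2, 0, 2], 1, [1, 3, -8, 5, 7, -10, -1, 8, -4]),
    ([2, 0, 2, 0, 0, 2, 0, 2, 2, 0, 0, 2], 1, [-1, -3, 8, -5, -7, 10, 1, -8, 4]),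
    ([2, 0, 1, 1, 1, 1, 2, 0, 0, 2, 0, 2], 2, [-1, 5, -1, -7, 5, 3, -6, 2]),
    ([2, 0, 2, 0, 0, 2, 1, 1, 1, 1, 0, 2], 2, [1, -5, 1, 7, -5, -3, 6, -2]),
    ([2, 0, 1, 1, 2, 0, 1, 1, 0, 2, 0, 2], 0, [1, 4, -8, 2, 4, -4, 0, 1]),
    ([2, 0, 2, 0, 1, 1, 0, 2, 1, 1, 0, 2], 0, [-1, -4, 8, -2, -4, 4, 0, -1])]
  scale := 1
  exps := (41, 7, 2, 1, 0)
  target := ![[1, -4, 4, 0, -6, 6, -2], [], [], [], [], [0, 0, 0, -2, 6, -6, 0, 4, -4, 1], [],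
    [], [1, -4, 4, 0, -6, 6, -2], [], [0, 0, 0, -2, 6, -6, 0, 4, -4, 1], []]

/-- The relations that determine the family. -/
def pascalRelations : List PascalRelation :=
  [pascalRelation_zero_eight, pascalRelation_one_seven, pascalRelation_two_six,
    pascalRelation_three_nine, pascalRelation_four_eleven, pascalRelation_five_ten,
    pascalRelation_two_zero, pascalRelation_three_zero_one, pascalRelation_four_zero,
    pascalRelation_five_zero]

/-- The first six certificates give equal weights to monomials with mutually reversed exponent lists
and yield the equalities of paired entries. The last four give such monomials opposite weights and
yield relations symmetric under the same pairing. -/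
theorem isValid_pascalRelations : pascalRelations.all isValid = true := by
  decide +kernel

end PascalRelation

/-! ### Vanishing forces membership in the family. -/

section Converse

variable {q s : ℂ} {I : Type*} [LinearOrder I]

open PascalRelation in
theorem exists_isPascalFamily (hs : s ^ 2 = q) (hq : ‖q‖ = 1) (hq1 : q ^ 2 ≠ 1)
    (hq4 : q ^ 2 ≠ -1) (hq8 : q ^ 4 ≠ -1) (hq12 : q ^ 4 - q ^ 2 + 1 ≠ 0) {p : Fin 7 → I}
    (hp : StrictMono p) {a : Fin 12 → ℂ} (h : pascalCombination q s p a = 0) :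
    ∃ α β : ℂ, IsPascalFamily q α β a := by
  have hs0 := root_ne_zero hs hq
  have hq0 : q ≠ 0 := hs ▸ pow_ne_zero 2 hs0
  have hD := pascalDenom_ne_zero hq
  have key : ∀ R ∈ pascalRelations, R.scale ≠ 0 →
      ∑ i, a i * coeffEval (q ^ 2) (R.target i) = 0 := fun R hR hn =>
    sum_target_eq_zero (List.all_eq_true.1 isValid_pascalRelations R hR) hn hs hs0 hq4 hq1 hq8
      hq12 hp h
  simp only [pascalRelations, List.forall_mem_cons, List.not_mem_nil, IsEmpty.forall_iff,
    implies_true, and_true] at key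
  obtain ⟨h08, h17, h26, h39, h411, h510, h2, h3, h4, h5⟩ := key
  replace h08 := h08 (by decide)
  replace h17 := h17 (by decide)
  replace h26 := h26 (by decide)
  replace h39 := h39 (by decide)
  replace h411 := h411 (by decide)
  replace h510 := h510 (by decide)
  replace h2 := h2 (by decide)
  replace h3 := h3 (by decide)
  replace h4 := h4 (by decide)
  replace h5 := h5 (by decide)
  simp only [pascalRelation_zero_eight, pascalRelation_one_seven, pascalRelation_two_six,
    pascalRelation_three_nine, pascalRelation_four_eleven, pascalRelation_five_ten,
    pascalRelation_two_zero, pascalRelation_three_zero_one, pascalRelation_four_zero,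
    pascalRelation_five_zero, Fin.sum_univ_succ, Finset.univ_eq_empty, Finset.sum_empty,
    Matrix.cons_val_zero, Matrix.cons_val_succ, coeffEval, mul_zero, add_zero, zero_add,
    Int.cast_zero, Int.cast_one, mul_one] at h08 h17 h26 h39 h411 h510 h2 h3 h4 h5
  have e8 : a 8 = a 0 := by
    change a 0 + a 8 * _ = 0 at h08
    push_cast at h08
    linear_combination -h08
  have e7 : a 7 = a 1 := by
    change a 1 + a 7 * _ = 0 at h17
    push_cast at h17
    linear_combination -h17
  have e6 : a 6 = a 2 := by
    change a 2 + a 6 * _ = 0 at h26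
    push_cast at h26
    linear_combination -h26
  have e9 : a 9 = a 3 := by
    change a 3 + a 9 * _ = 0 at h39
    push_cast at h39
    linear_combination -h39
  have e11 : a 11 = a 4 := by
    change a 4 + a 11 * _ = 0 at h411
    push_cast at h411
    linear_combination -h411
  have e10 : a 10 = a 5 := by
    change a 5 + a 10 * _ = 0 at h510
    push_cast at h510
    linear_combination -h510
  change a 0 * _ + (a 2 * _ + (a 6 * _ + a 8 * _)) = 0 at h2
  change a 0 * _ + (a 1 * _ + (a 3 * _ + (a 7 * _ + (a 8 * _ + a 9 * _)))) = 0 at h3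
  change a 0 * _ + (a 4 * _ + (a 8 * _ + a 11 * _)) = 0 at h4
  change a 0 * _ + (a 5 * _ + (a 8 * _ + a 10 * _)) = 0 at h5
  push_cast at h2 h3 h4 h5
  rw [e6, e8] at h2
  rw [e7, e8, e9] at h3
  rw [e8, e11] at h4
  rw [e8, e10] at h5
  refine ⟨a 0, a 1, rfl, e8, rfl, e7, ?_, e6, ?_, e9, ?_, e11, ?_, e10⟩
  · field_simp
    unfold pascalDenom
    -- Once the paired entries are identified, each of the last four relations is twice the wanted
    -- one with the denominator cleared; hence the division by two here and below.
    linear_combination h2 / 2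
  · field_simp
    unfold pascalDenom
    linear_combination h3 / 2
  · field_simp
    unfold pascalDenom
    linear_combination h4 / 2
  · field_simp
    unfold pascalDenom
    linear_combination h5 / 2

end Converse

theorem theorem3 (q s : ℂ) (hs : s ^ 2 = q) (hq : ‖q‖ = 1) (hq1 : q ≠ 1) (hq2 : q ≠ -1)
    (hq4 : q ^ 2 ≠ -1) {I : Type*} [LinearOrder I] (p : Fin 7 → I) (hp : StrictMono p) :
    (∀ a : Fin 12 → ℂ, IsQInvariant hs hq (pascalCombination q s p a)) ∧
    (∀ a : Fin 12 → ℂ, (∃ α β : ℂ, IsPascalFamily q α β a) → pascalCombination q s p a = 0) ∧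
    (q ^ 4 ≠ -1 → q ^ 4 - q ^ 2 + 1 ≠ 0 → ∀ a : Fin 12 → ℂ,
      (pascalCombination q s p a = 0 ↔ ∃ α β : ℂ, IsPascalFamily q α β a)) := by
  have hfam : ∀ a : Fin 12 → ℂ, (∃ α β : ℂ, IsPascalFamily q α β a) →
      pascalCombination q s p a = 0 := fun a ⟨_, _, h⟩ =>
    pascalCombination_eq_zero_of_isPascalFamily hs hq hq4 hp h
  refine ⟨isQInvariant_pascalCombination hq4 p, hfam, fun hq8 hq12 a => ⟨fun h => ?_, hfam a⟩⟩
  refine exists_isPascalFamily hs hq (fun h1 => ?_) hq4 hq8 hq12 hp h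
  rcases (mul_self_eq_one_iff.1 ((sq q).symm.trans h1)) with h1 | h1
  · exact hq1 h1
  · exact hq2 h1
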